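/- **Setting.** Let $m\ge 1$, $\mathcal N=\{1,\dots,m\}$, let $X_1,\dots,X_m\subset\mathbb R^n$ and $\Theta\subseteq\mathbb R^p$, and let $\xi$, $\chi$ be random vectors in $\mathbb R^d$, $\mathbb R^r$. Let $\varphi_i:\mathbb R^n\times\mathbb R^p\times\mathbb R^d\to\mathbb R$ ($i\in\mathcal N$) and $g:\mathbb R^p\times\mathbb R^r\to\mathbb R$ be measurable, $\varphi_i(\cdot,\theta,s)$ continuously differentiable for all $\theta\in\Theta$, $s\in\mathbb R^d$, and $g(\cdot,c)$ continuously differentiable for all $c\in\mathbb R^r$. Put $f_i(x,\theta)=\mathbb E[\varphi_i(x,\theta,\xi)]$ and $h(\theta)=\mathbb E[g(\theta,\chi)]$ for $x\in\mathbb R^n$, $\theta\in\Theta$; these expectations are finite, $f_i(\cdot,\theta)$ and $h$ (within $\Theta$) are differentiable, and $\nabla_xf_i(x,\theta)=\mathbb E[\nabla_x\varphi_i(x,\theta,\xi)]$, $\nabla h(\theta)=\mathbb E[\nabla_\theta g(\theta,\chi)]$ with integrable right-hand sides. **Algorithm.** On a probability space let $\xi_i^k$, $\chi_i^k$ ($i\in\mathcal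 N$, $k\ge0$) be random vectors in $\mathbb R^d$, $\mathbb R^r$ (the samples) and let $x_i^0\in X_i$, $\theta_i^0\in\Theta$ be random initial points. With weights $a_i^{j,k}\ge 0$ and stepsizes $\alpha_k,\gamma_k>0$, put for $k\ge0$, $i\in\mathcal N$ $$v_i^k=\sum_{j=1}^m a_i^{j,k}x_j^k,\qquad x_i^{k+1}=\Pi_{X_i}\bigl(v_i^k-\alpha_k(\nabla_xf_i(v_i^k,\theta_i^k)+w_i^k)\bigr),\qquad \theta_i^{k+1}=\Pi_{\Theta}\bigl(\theta_i^k-\gamma_k(\nabla h(\theta_i^k)+\beta_i^k)\bigr),$$ where $\Pi_C$ is the Euclidean projection onto $C$, $w_i^k=\nabla_x\varphi_i(v_i^k,\theta_i^k,\xi_i^k)-\nabla_xf_i(v_i^k,\theta_i^k)$ and $\beta_i^k=\nabla_\theta g(\theta_i^k,\chi_i^k)-\nabla h(\theta_i^k)$. Let $\mathcal F_k$ be the $\sigma$-algebra generated by all $x_i^0,\theta_i^0$ and all $\xi_i^t,\chi_i^t$ with $t<k$. **Assumptions.** 1. For every $k$ there is a connected undirected graph $\mathcal G^k$ on $\mathcal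 N$ such that $a_i^{j,k}>0$ if $j=i$ or $\{j,i\}$ is an edge of $\mathcal G^k$, and $a_i^{j,k}=0$ otherwise. The matrix $(a_i^{j,k})_{i,j}$ is doubly stochastic for every $k$, and there is $\eta>0$ such that $a_i^{j,k}\ge\eta$ whenever $a_i^{j,k}>0$, for all $i,j,k$. 2. $w_i^k$ and $\beta_i^k$ are square integrable, and there are constants $\nu,\nu_\theta$ such that, almost surely for all $i,k$, $\mathbb E[w_i^k\mid\mathcal F_k]=0$, $\mathbb E[\beta_i^k\mid\mathcal F_k]=0$, $\mathbb E[\|w_i^k\|^2\mid\mathcal F_k]\le\nu^2$ and $\mathbb E[\|\beta_i^k\|^2\mid\mathcal F_k]\le\nu_\theta^2$. Moreover $\mathbb E[\|\theta_i^0\|^2]<\infty$ for all $i$. 3. Each $X_i$ is convex and compact, $\Theta$ is convex and closed, and $X=\bigcap_{i=1}^mX_i$ has nonempty interior. 4. For every $i$ and every $\theta\in\Theta$, $f_i(\cdot,\theta)$ is convex on $\mathbb R^n$, and there is a constant $L_\theta$ with $\|\nabla_xf_i(x,\theta^a)-\nabla_xf_i(x,\theta^b)\|\le L_\theta\|\theta^a-\theta^b\|$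 for all $\theta^a,\theta^b\in\Theta$, all $x\in\operatorname{conv}\bigl(\bigcup_{j=1}^mX_j\bigr)$ and all $i$. 5. $h$ is strongly convex over $\Theta$ with some constant $\kappa>0$, and $\nabla h$ is Lipschitz continuous on $\Theta$. Let $\theta^*$ denote the minimizer of $h$ over $\Theta$. 6. $\sum_k\gamma_k=\infty$, $\sum_k\gamma_k^2<\infty$, $\sum_k\alpha_k=\infty$, and for some $\tau\in(0,2)$, $\sum_k\alpha_k^{2-\tau}<\infty$ and $\lim_{k\to\infty}\alpha_k^\tau/\gamma_k=0$. **Conclusion.** Let $X^*$ be the set of minimizers of $\sum_{i=1}^mf_i(x,\theta^*)$ over $x\in X$. Then there is a random vector $z^*$ with values in $X^*$ such that, almost surely, $\lim_{k\to\infty}x_j^k=z^*$ for all $j\in\mathcal N$. -/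

import Mathlib

open MeasureTheory ProbabilityTheory Filter Topology Set

noncomputable section

/-- Euclidean space of dimension `n`. -/
abbrev Euc (n : ℕ) : Type := EuclideanSpace ℝ (Fin n)

/-- The expected value function `y ↦ 𝔼[ψ(y, ζ)]`, where the random variable `ζ` has law `μ`. -/
def expVal {q d : ℕ} (ψ : Euc q → Euc d → ℝ) (μ : Measure (Euc d)) (y : Euc q) : ℝ :=
  ∫ s, ψ y s ∂μ

/-- The expected gradient `y ↦ 𝔼[∇_y ψ(y, ζ)]`, where the random variable `ζ` has law `μ`. -/
def expGrad {q d : ℕ} (ψ : Euc q → Euc d → ℝ) (μ : Measure (Euc d)) (y : Euc q) : Euc q :=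
  ∫ s, gradient (fun z => ψ z s) y ∂μ

/-- The local cost `f_i(x, θ) = 𝔼[φ_i(x, θ, ξ)]` of agent `i`, where `ξ` has law `μ`. -/
def localCost {m n p d : ℕ} (φ : Fin m → Euc n → Euc p → Euc d → ℝ) (μ : Measure (Euc d))
    (i : Fin m) (x : Euc n) (θ : Euc p) : ℝ :=
  expVal (fun y s => φ i y θ s) μ x

/-- The gradient `∇_x f_i(x, θ) = 𝔼[∇_x φ_i(x, θ, ξ)]`, where `ξ` has law `μ`. -/
def localGrad {m n p d : ℕ} (φ : Fin m → Euc n → Euc p → Euc d → ℝ) (μ : Measure (Euc d))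
    (i : Fin m) (x : Euc n) (θ : Euc p) : Euc n :=
  expGrad (fun y s => φ i y θ s) μ x

/-- The set of minimizers over `⋂ i, X i` of the aggregate cost `x ↦ ∑ i, f_i(x, θ)`. -/
def solutionSet {m n p d : ℕ} (φ : Fin m → Euc n → Euc p → Euc d → ℝ) (μ : Measure (Euc d))
    (X : Fin m → Set (Euc n)) (θ : Euc p) : Set (Euc n) :=
  {x | x ∈ ⋂ i, X i ∧ IsMinOn (fun y => ∑ i, localCost φ μ i y θ) (⋂ i, X i) x}

/-- `q` is a Euclidean projection of `u` onto `C`, that is, a point of `C` nearest to `u`.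
For a nonempty closed convex set `C` there is exactly one such point. -/
def IsProjection {n : ℕ} (C : Set (Euc n)) (u q : Euc n) : Prop :=
  q ∈ C ∧ ∀ c ∈ C, ‖u - q‖ ≤ ‖u - c‖

/-- The average `v_i^k = ∑ j, a_i^{j,k} x_j^k`; the entry `A k i j` is the weight `a_i^{j,k}`. -/
def average {m n : ℕ} {Ω : Type*} (A : ℕ → Matrix (Fin m) (Fin m) ℝ)
    (x : Fin m → ℕ → Ω → Euc n) (i : Fin m) (k : ℕ) (ω : Ω) : Euc n :=
  ∑ j, A k i j • x j k ω

/-- The error `w_i^k = ∇_x φ_i(v_i^k, θ_i^k, ξ_i^k) - ∇_x f_i(v_i^k, θ_i^k)` of the sampled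
gradient of the cost of agent `i`. -/
def costNoise {m n p d : ℕ} {Ω : Type*} (φ : Fin m → Euc n → Euc p → Euc d → ℝ)
    (μ : Measure (Euc d)) (A : ℕ → Matrix (Fin m) (Fin m) ℝ)
    (x : Fin m → ℕ → Ω → Euc n) (θ : Fin m → ℕ → Ω → Euc p) (ξ : Fin m → ℕ → Ω → Euc d)
    (i : Fin m) (k : ℕ) (ω : Ω) : Euc n :=
  gradient (fun y => φ i y (θ i k ω) (ξ i k ω)) (average A x i k ω)
    - localGrad φ μ i (average A x i k ω) (θ i k ω)

/-- The error `β_i^k = ∇_θ g(θ_i^k, χ_i^k) - ∇h(θ_i^k)` of the sampled gradient of the learning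
function `h`. -/
def learnNoise {m p r : ℕ} {Ω : Type*} (g : Euc p → Euc r → ℝ) (μ : Measure (Euc r))
    (θ : Fin m → ℕ → Ω → Euc p) (χ : Fin m → ℕ → Ω → Euc r)
    (i : Fin m) (k : ℕ) (ω : Ω) : Euc p :=
  gradient (fun t => g t (χ i k ω)) (θ i k ω) - expGrad g μ (θ i k ω)

/-- The sigma-algebra `ℱ_k` generated by the initial points `x_i^0`, `θ_i^0` and by the samples
`ξ_i^t`, `χ_i^t` with `t < k`, over all agents `i`. -/
def history {m n p d r : ℕ} {Ω : Type*} (x : Fin m → ℕ → Ω → Euc n)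
    (θ : Fin m → ℕ → Ω → Euc p) (ξ : Fin m → ℕ → Ω → Euc d) (χ : Fin m → ℕ → Ω → Euc r)
    (k : ℕ) : MeasurableSpace Ω :=
  (⨆ i, MeasurableSpace.comap (x i 0) inferInstance
      ⊔ MeasurableSpace.comap (θ i 0) inferInstance)
    ⊔ ⨆ i, ⨆ t, ⨆ (_ : t < k), MeasurableSpace.comap (ξ i t) inferInstance
      ⊔ MeasurableSpace.comap (χ i t) inferInstance

end

/-! Fix one outcome and put V(z) = ∑_j ‖x_j - z‖² for a minimizer z. Projecting onto X_i does not
increase the distance to z, and doubly stochastic averaging lowers V by exactly the weighted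
variance of the x_j about their averages (`sum_average_norm_sq`). Connectivity and the lower bound η
make this loss at least a multiple of δ², where δ bounds all disagreements (`exists_disagreement`).
Since X has interior, some p ∈ X lies within a multiple of δ of all iterates
(`exists_mem_iInter_near`). Comparing costs at p introduces an error of order αδ, which half of the
δ² loss absorbs up to O(α²). So V falls by cδ² + 2α(F(p) - F(z)), with F the aggregate cost at θ*,
up to the terms of a convergent series. Hence V(z) converges and δ → 0, and since ∑ α = ∞, F(p)
approaches its minimum along a subsequence. A cluster point of p there is a minimizer; V at that
point converges and has a subsequence tending to 0, so it tends to 0 (`exists_minimizer_tendsto`).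

Two facts control the errors almost surely. Strong convexity makes the mean square learning error
contract, so ∑ γ E‖θ - θ*‖² < ∞ (`summable_stochastic_gradient`); α^τ = o(γ) and ∑ α^(2-τ) < ∞ turn
this into ∑ α‖θ - θ*‖ < ∞ by AM-GM. The noise α⟨w, v - z⟩ splits into α⟨w, v⟩ and α⟨w, z⟩, which
give L²-bounded martingales for fixed z. The second is linear in z, so convergence for basis vectors
yields one null set valid for every z, including the random cluster point. -/

/-! ### Euclidean projections -/

theorem IsProjection.inner_le_zero {n : ℕ} {C : Set (Euc n)} (hC : Convex ℝ C) {u q : Euc n}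
    (h : IsProjection C u q) {c : Euc n} (hc : c ∈ C) : inner ℝ (u - q) (c - q) ≤ 0 := by
  have hne : Nonempty C := ⟨⟨q, h.1⟩⟩
  have hq : ‖u - q‖ = ⨅ w : C, ‖u - w‖ := by
    refine le_antisymm (le_ciInf fun w => h.2 w w.2) ?_
    exact ciInf_le (f := fun w : C => ‖u - w‖) ⟨0, by rintro _ ⟨w, rfl⟩; positivity⟩ ⟨q, h.1⟩
  exact (norm_eq_iInf_iff_real_inner_le_zero hC h.1).1 hq c hc

theorem IsProjection.dist_sq_le {n : ℕ} {C : Set (Euc n)} (hC : Convex ℝ C) {u q : Euc n}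
    (h : IsProjection C u q) {c : Euc n} (hc : c ∈ C) : ‖q - c‖ ^ 2 ≤ ‖u - c‖ ^ 2 := by
  have h1 := h.inner_le_zero hC hc
  have h2 : ‖u - c‖ ^ 2 = ‖u - q‖ ^ 2 - 2 * inner ℝ (u - q) (c - q) + ‖c - q‖ ^ 2 := by
    rw [← norm_sub_sq_real]; congr 2; abel
  have h3 : ‖q - c‖ = ‖c - q‖ := norm_sub_rev _ _
  rw [h3]
  nlinarith [sq_nonneg ‖u - q‖]

theorem IsProjection.dist_le {n : ℕ} {C : Set (Euc n)} (hC : Convex ℝ C) {u q u' q' : Euc n}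
    (h : IsProjection C u q) (h' : IsProjection C u' q') : dist q q' ≤ dist u u' := by
  have h1 := h.inner_le_zero hC h'.1
  have h2 := h'.inner_le_zero hC h.1
  have h3 : inner ℝ (u - q) (q' - q) + inner ℝ (u' - q') (q - q')
      = ‖q - q'‖ ^ 2 - inner ℝ (u - u') (q - q') := by
    rw [← real_inner_self_eq_norm_sq]
    simp only [inner_sub_left, inner_sub_right]
    ring
  have h4 := real_inner_le_norm (u - u') (q - q')
  rw [dist_eq_norm, dist_eq_norm]
  by_contra hlt
  push Not at hlt
  nlinarith [norm_nonneg (u - u'), norm_nonneg (q - q')]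

/-- A choice of projection onto a closed convex set, as a continuous map. -/
theorem exists_continuous_projection {n : ℕ} {C : Set (Euc n)} (hne : C.Nonempty)
    (hC : Convex ℝ C) (hcl : IsClosed C) :
    ∃ π : Euc n → Euc n, Continuous π ∧ ∀ u q, IsProjection C u q → q = π u := by
  have hex : ∀ u, ∃ q, IsProjection C u q := fun u => by
    obtain ⟨q, hq, hmin⟩ := hcl.exists_infDist_eq_dist hne u
    refine ⟨q, hq, fun c hc => ?_⟩
    rw [← dist_eq_norm, ← dist_eq_norm, ← hmin]
    exact Metric.infDist_le_dist_of_mem hc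
  choose π hπ using hex
  refine ⟨π, (LipschitzWith.of_dist_le_mul (K := 1) fun u u' => ?_).continuous, fun u q hq => ?_⟩
  · simpa using (hπ u).dist_le hC (hπ u')
  · simpa using hq.dist_le hC (hπ u)

/-! ### Gradient inequalities for convex functions -/

section Convexity

variable {E : Type*} [NormedAddCommGroup E] [InnerProductSpace ℝ E] [CompleteSpace E]

/-- The derivative exists only within C, so difference quotients are taken at x + t(y - x) ∈ C with
t = 1/(n+1). Strong convexity bounds each by f y - f x - (1 - t)κ/2 ‖y - x‖²; let t → 0. -/
theorem StrongConvexOn.add_inner_add_le {C : Set E} {κ : ℝ} {f : E → ℝ} {f' x y : E}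
    (hf : StrongConvexOn C κ f) (hx : x ∈ C) (hy : y ∈ C) (hd : HasGradientWithinAt f f' C x) :
    f x + inner ℝ f' (y - x) + κ / 2 * ‖y - x‖ ^ 2 ≤ f y := by
  have ht : ∀ n : ℕ, (0 : ℝ) < 1 / (n + 1) ∧ 1 / ((n : ℝ) + 1) ≤ 1 := fun n =>
    ⟨by positivity, by rw [div_le_one (by positivity)]; linarith [n.cast_nonneg (α := ℝ)]⟩
  have hlim0 : Tendsto (fun n : ℕ => 1 / ((n : ℝ) + 1)) atTop (𝓝 0) :=
    tendsto_one_div_add_atTop_nhds_zero_nat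
  have hmem : ∀ n : ℕ, x + (1 / ((n : ℝ) + 1)) • (y - x) ∈ C := fun n =>
    hf.1.add_smul_sub_mem hx hy ⟨(ht n).1.le, (ht n).2⟩
  have hd0 : Tendsto (fun n : ℕ => (1 / ((n : ℝ) + 1)) • (y - x)) atTop (𝓝 0) := by
    simpa using hlim0.smul_const (y - x)
  have hlim := hd.hasFDerivWithinAt.lim (c := fun n : ℕ => (n : ℝ) + 1) (v := y - x) hd0
    (Eventually.of_forall hmem) (tendsto_const_nhds.congr fun n => by
      rw [smul_smul, mul_one_div_cancel (by positivity), one_smul])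
  have hub : Tendsto (fun n : ℕ => f y - f x - (1 - 1 / ((n : ℝ) + 1)) * (κ / 2 * ‖y - x‖ ^ 2))
      atTop (𝓝 (f y - f x - (1 - 0) * (κ / 2 * ‖y - x‖ ^ 2))) :=
    tendsto_const_nhds.sub ((tendsto_const_nhds.sub hlim0).mul_const _)
  have hle := le_of_tendsto_of_tendsto' hlim hub fun n => by
    obtain ⟨h0, h1⟩ := ht n
    have h2 := hf.2 hx hy (sub_nonneg.2 h1) h0.le (by ring)
    have h3 : (1 - 1 / ((n : ℝ) + 1)) • x + (1 / ((n : ℝ) + 1)) • y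
        = x + (1 / ((n : ℝ) + 1)) • (y - x) := by rw [sub_smul, one_smul, smul_sub]; abel
    rw [h3, norm_sub_rev x y] at h2
    simp only [smul_eq_mul] at h2 ⊢
    have h4 : (n : ℝ) + 1 = 1 / (1 / ((n : ℝ) + 1)) := by rw [one_div_one_div]
    generalize 1 / ((n : ℝ) + 1) = t at *
    rw [h4, one_div_mul_eq_div, div_le_iff₀ h0]
    linarith
  rw [InnerProductSpace.toDual_apply_apply] at hle
  linarith

theorem ConvexOn.add_inner_le {f : E → ℝ} {f' x : E} (hf : ConvexOn ℝ univ f)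
    (hd : HasGradientAt f f' x) (y : E) : f x + inner ℝ f' (y - x) ≤ f y := by
  have h := StrongConvexOn.add_inner_add_le (strongConvexOn_zero.2 hf) (mem_univ x) (mem_univ y)
    (hasGradientWithinAt_univ.2 hd)
  simpa using h

theorem StrongConvexOn.le_inner_sub_minimizer {C : Set E} {κ : ℝ} {f : E → ℝ} {f' x y : E}
    (hf : StrongConvexOn C κ f) (hx : x ∈ C) (hy : y ∈ C) (hd : HasGradientWithinAt f f' C x)
    (hmin : IsMinOn f C y) : κ / 2 * ‖x - y‖ ^ 2 ≤ inner ℝ f' (x - y) := by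
  have h1 := hf.add_inner_add_le hx hy hd
  have h2 := hmin hx
  have h3 : inner ℝ f' (y - x) = - inner ℝ f' (x - y) := by rw [← inner_neg_right, neg_sub]
  rw [norm_sub_rev x y]
  change f y ≤ f x at h2
  linarith

/-- No continuity of the gradient is needed: a convex function bounded on the ball of radius r + 2
is Lipschitz on that of radius r + 1, and the Lipschitz constant bounds the gradient at its interior
points. -/
theorem ConvexOn.exists_bound_gradient [FiniteDimensional ℝ E] {f : E → ℝ} {f' : E → E}
    (hf : ConvexOn ℝ univ f) (hd : ∀ x, HasGradientAt f (f' x) x) (r : ℝ) :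
    ∃ B, 0 ≤ B ∧ ∀ x, ‖x‖ ≤ r → ‖f' x‖ ≤ B := by
  have hball : ConvexOn ℝ (Metric.ball (0 : E) (r + 2)) f :=
    hf.subset (subset_univ _) (convex_ball _ _)
  have hcont : Continuous f := hf.locallyLipschitz.continuous
  have hbdd : Bornology.IsBounded (f '' Metric.ball (0 : E) (r + 2)) :=
    ((isCompact_closedBall (0 : E) (r + 2)).image hcont).isBounded.subset
      (image_mono Metric.ball_subset_closedBall)
  obtain ⟨K, hK⟩ := hball.exists_lipschitzOnWith_of_isBounded (r' := r + 1) (by linarith) hbdd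
  refine ⟨K, K.2, fun x hx => ?_⟩
  rw [← (InnerProductSpace.toDual ℝ E).norm_map]
  refine (hd x).hasFDerivAt.le_of_lipschitzOn (Metric.isOpen_ball.mem_nhds ?_) hK
  rw [mem_ball_zero_iff]; linarith

end Convexity

/-! ### Averaging, disagreement and distance to the intersection -/

section Averages

variable {E : Type*} [NormedAddCommGroup E] [InnerProductSpace ℝ E] {m : ℕ}

/-- Bias-variance decomposition: the cross term vanishes because the weighted deviations from the
mean sum to zero. -/
theorem sum_weights_norm_sq (a : Fin m → ℝ) (ha : ∑ j, a j = 1) (x : Fin m → E) (z : E) :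
    ∑ j, a j * ‖x j - z‖ ^ 2
      = ‖∑ j, a j • x j - z‖ ^ 2 + ∑ j, a j * ‖x j - ∑ l, a l • x l‖ ^ 2 := by
  set v := ∑ l, a l • x l with hv
  have h0 : ∑ j, a j * inner ℝ (x j - v) (v - z) = 0 := by
    simp_rw [← real_inner_smul_left, ← sum_inner, smul_sub, Finset.sum_sub_distrib,
      ← Finset.sum_smul, ha, one_smul, ← hv, sub_self, inner_zero_left]
  have h1 : ∀ j, a j * ‖x j - z‖ ^ 2 = a j * ‖x j - v‖ ^ 2
      + 2 * (a j * inner ℝ (x j - v) (v - z)) + a j * ‖v - z‖ ^ 2 := fun j => by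
    rw [← sub_add_sub_cancel (x j) v z, norm_add_sq_real]; ring
  simp_rw [h1, Finset.sum_add_distrib, ← Finset.mul_sum, h0, ← Finset.sum_mul, ha]
  ring

/-- Row sums equal to one give the decomposition for each i; column sums equal to one collapse the
sum over i. -/
theorem sum_average_norm_sq {A : Matrix (Fin m) (Fin m) ℝ} (hA : A ∈ doublyStochastic ℝ (Fin m))
    (x : Fin m → E) (z : E) :
    ∑ i, ‖∑ j, A i j • x j - z‖ ^ 2 + ∑ i, ∑ j, A i j * ‖x j - ∑ l, A i l • x l‖ ^ 2
      = ∑ j, ‖x j - z‖ ^ 2 := by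
  rw [← Finset.sum_add_distrib]
  simp_rw [← sum_weights_norm_sq (A _) (sum_row_of_mem_doublyStochastic hA _) x z]
  rw [Finset.sum_comm]
  simp_rw [← Finset.sum_mul, sum_col_of_mem_doublyStochastic hA, one_mul]

/-- A weight at least η forces x_j within s = √(S/η) of v_i, where S is the total variance.
Neighbours are then 2s apart, and a path has fewer than m edges, so δ = 2ms works and makes the last
inequality an equality. -/
theorem exists_disagreement {A : Matrix (Fin m) (Fin m) ℝ} (hA : A ∈ doublyStochastic ℝ (Fin m))
    {G : SimpleGraph (Fin m)} (hG : G.Connected) {η : ℝ} (hη : 0 < η)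
    (hpos : ∀ i j, (j = i ∨ G.Adj j i) → η ≤ A i j) (x : Fin m → E) :
    ∃ δ, 0 ≤ δ ∧ (∀ i j, ‖x i - x j‖ ≤ δ) ∧ (∀ i j, ‖∑ l, A i l • x l - x j‖ ≤ 2 * δ) ∧
      η / (2 * (m : ℝ)) ^ 2 * δ ^ 2 ≤ ∑ i, ∑ j, A i j * ‖x j - ∑ l, A i l • x l‖ ^ 2 := by
  set v : Fin m → E := fun i => ∑ l, A i l • x l with hv
  set S := ∑ i, ∑ j, A i j * ‖x j - v i‖ ^ 2 with hS
  have hm : 0 < (m : ℝ) := by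
    obtain ⟨i⟩ := hG.nonempty
    exact_mod_cast i.pos
  have hm1 : 1 ≤ (m : ℝ) := by exact_mod_cast hm
  have hA0 : ∀ i j, 0 ≤ A i j := fun i j => nonneg_of_mem_doublyStochastic hA
  have hterm : ∀ i j, 0 ≤ A i j * ‖x j - v i‖ ^ 2 := fun i j => mul_nonneg (hA0 i j) (by positivity)
  have hS0 : 0 ≤ S := Finset.sum_nonneg fun i _ => Finset.sum_nonneg fun j _ => hterm i j
  set s := √(S / η) with hs
  have hs0 : 0 ≤ s := Real.sqrt_nonneg _
  have hclose : ∀ i j, (j = i ∨ G.Adj j i) → ‖x j - v i‖ ≤ s := fun i j h => by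
    refine Real.le_sqrt_of_sq_le ?_
    rw [le_div_iff₀ hη]
    calc ‖x j - v i‖ ^ 2 * η ≤ A i j * ‖x j - v i‖ ^ 2 := by
          rw [mul_comm]; gcongr; exact hpos i j h
      _ ≤ ∑ j, A i j * ‖x j - v i‖ ^ 2 :=
          Finset.single_le_sum (f := fun j => A i j * ‖x j - v i‖ ^ 2) (fun j _ => hterm i j)
            (Finset.mem_univ j)
      _ ≤ S := Finset.single_le_sum (f := fun i => ∑ j, A i j * ‖x j - v i‖ ^ 2)
            (fun i _ => Finset.sum_nonneg fun j _ => hterm i j) (Finset.mem_univ i)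
  have hadj : ∀ i j, G.Adj i j → ‖x i - x j‖ ≤ 2 * s := fun i j h => by
    have h1 := hclose i i (Or.inl rfl)
    have h2 := hclose i j (Or.inr h.symm)
    calc ‖x i - x j‖ = ‖(x i - v i) - (x j - v i)‖ := by congr 1; abel
      _ ≤ _ := (norm_sub_le _ _).trans (by linarith)
  have hwalk : ∀ {i j : Fin m} (p : G.Walk i j), ‖x i - x j‖ ≤ 2 * s * p.length := by
    intro i j p
    induction p with
    | nil => simp
    | cons h p ih =>
      rename_i a b c
      have := norm_sub_le_norm_sub_add_norm_sub (x a) (x b) (x c)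
      have := hadj _ _ h
      rw [SimpleGraph.Walk.length_cons]; push_cast
      linarith
  have hall : ∀ i j, ‖x i - x j‖ ≤ 2 * m * s := fun i j => by
    obtain ⟨p, hp⟩ := hG.exists_isPath i j
    have h1 := hp.length_lt
    rw [Fintype.card_fin] at h1
    have h2 : (p.length : ℝ) ≤ m := by exact_mod_cast h1.le
    calc _ ≤ 2 * s * p.length := hwalk p
      _ ≤ 2 * s * m := by gcongr
      _ = _ := by ring
  refine ⟨2 * m * s, by positivity, hall, fun i j => ?_, ?_⟩
  · have h1 := hclose i i (Or.inl rfl)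
    have h2 := hall i j
    have h3 : ‖v i - x j‖ ≤ ‖x i - v i‖ + ‖x i - x j‖ := by
      calc ‖v i - x j‖ = ‖(x i - x j) - (x i - v i)‖ := by congr 1; abel
        _ ≤ _ := (norm_sub_le _ _).trans (by linarith)
    have h4 : s ≤ 2 * m * s := le_mul_of_one_le_left hs0 (by linarith)
    show ‖v i - x j‖ ≤ _
    linarith
  · have : s ^ 2 = S / η := Real.sq_sqrt (by positivity)
    rw [mul_pow _ s, this]
    refine le_of_eq ?_
    field_simp

/-- If the sets `X j` have a common interior point, a point at distance at most `δ` from each `X j`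
is within a multiple of `δ` of the intersection. -/
theorem exists_mem_iInter_near {ι : Type*} {X : ι → Set E} (hX : ∀ j, Convex ℝ (X j)) {c : E} {ρ : ℝ}
    (hρ : 0 < ρ) (hc : Metric.closedBall c ρ ⊆ ⋂ j, X j) {q : E} {x : ι → E} (hx : ∀ j, x j ∈ X j)
    {δ : ℝ} (hδ : 0 ≤ δ) (hq : ∀ j, ‖q - x j‖ ≤ δ) :
    ∃ p ∈ ⋂ j, X j, ‖q - p‖ ≤ δ / ρ * ‖q - c‖ := by
  -- This weight satisfies tρ/δ = 1 - t, so (1 - t)q + tc = (1 - t)x_j + t(c + (ρ/δ)(q - x_j)), a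
  -- convex combination of x_j and a point of the ball around c.
  set t := δ / (δ + ρ) with ht
  have hs : 1 - t = ρ / (δ + ρ) := by rw [ht]; field_simp; ring
  have hs0 : 0 < 1 - t := by rw [hs]; positivity
  have ht0 : 0 ≤ t := by positivity
  refine ⟨(1 - t) • q + t • c, mem_iInter.2 fun j => ?_, ?_⟩
  · rcases hδ.eq_or_lt with h0 | h0
    · have h1 : q = x j := by
        have := hq j; rw [← h0] at this
        exact sub_eq_zero.1 (norm_le_zero_iff.1 this)
      have : t = 0 := by rw [ht, ← h0]; simp
      rw [this, h1]; simpa using hx j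
    · have hmem : c + (ρ / δ) • (q - x j) ∈ X j := by
        refine mem_iInter.1 (hc ?_) j
        rw [mem_closedBall_iff_norm, add_sub_cancel_left, norm_smul, Real.norm_eq_abs,
          abs_of_nonneg (by positivity)]
        calc ρ / δ * ‖q - x j‖ ≤ ρ / δ * δ := by gcongr; exact hq j
          _ = ρ := by field_simp
      have := hX j (hx j) hmem hs0.le ht0 (by ring)
      convert this using 1
      have h2 : t * (ρ / δ) = 1 - t := by rw [hs, ht]; field_simp
      rw [smul_add, smul_smul, h2, smul_sub]
      abel
  · have : q - ((1 - t) • q + t • c) = t • (q - c) := by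
      rw [sub_smul, one_smul, smul_sub]; abel
    rw [this, norm_smul, Real.norm_eq_abs, abs_of_nonneg ht0]
    gcongr
    rw [ht]; gcongr; linarith

end Averages

/-! ### Descent along one trajectory -/

/-- The series `∑ k, e k` converges, possibly only conditionally. -/
def SeriesConverges (e : ℕ → ℝ) : Prop :=
  ∃ l, Tendsto (fun n => ∑ k ∈ Finset.range n, e k) atTop (𝓝 l)

theorem Summable.seriesConverges {e : ℕ → ℝ} (h : Summable e) : SeriesConverges e :=
  ⟨_, h.hasSum.tendsto_sum_nat⟩

theorem SeriesConverges.add {e e' : ℕ → ℝ} (h : SeriesConverges e) (h' : SeriesConverges e') :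
    SeriesConverges fun k => e k + e' k := by
  obtain ⟨l, hl⟩ := h
  obtain ⟨l', hl'⟩ := h'
  exact ⟨l + l', by simpa only [Finset.sum_add_distrib] using hl.add hl'⟩

theorem SeriesConverges.const_mul {e : ℕ → ℝ} (h : SeriesConverges e) (c : ℝ) :
    SeriesConverges fun k => c * e k := by
  obtain ⟨l, hl⟩ := h
  exact ⟨c * l, by simpa only [Finset.mul_sum] using hl.const_mul c⟩

theorem SeriesConverges.sum {ι : Type*} {s : Finset ι} {e : ι → ℕ → ℝ}
    (h : ∀ i ∈ s, SeriesConverges (e i)) : SeriesConverges fun k => ∑ i ∈ s, e i k := by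
  choose! l hl using h
  refine ⟨∑ i ∈ s, l i, ?_⟩
  simp_rw [Finset.sum_comm (t := s)]
  exact tendsto_finsetSum s hl

/-- A nonnegative sequence that decreases by `a k ≥ 0` up to the terms of a convergent series
converges, and `∑ k, a k` is finite. -/
theorem summable_and_tendsto_of_descent {V a e : ℕ → ℝ} (hV : ∀ k, 0 ≤ V k) (ha : ∀ k, 0 ≤ a k)
    (he : SeriesConverges e) (h : ∀ k, V (k + 1) ≤ V k - a k + e k) :
    Summable a ∧ ∃ l, Tendsto V atTop (𝓝 l) := by
  obtain ⟨l, hl⟩ := he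
  obtain ⟨M, hM⟩ := hl.bddAbove_range
  have hM' : ∀ n, ∑ k ∈ Finset.range n, e k ≤ M := fun n => hM ⟨n, rfl⟩
  -- The compensated quantity is nonincreasing, and it is bounded below because the partial sums of
  -- e are bounded above.
  have hanti : Antitone fun n =>
      V n + ∑ k ∈ Finset.range n, a k - ∑ k ∈ Finset.range n, e k := by
    refine antitone_nat_of_succ_le fun n => ?_
    rw [Finset.sum_range_succ, Finset.sum_range_succ]
    linarith [h n]
  have hsum : Summable a := by
    refine summable_of_sum_range_le (c := V 0 + M) ha fun n => ?_
    have h1 := hanti (Nat.zero_le n)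
    simp only [Finset.range_zero, Finset.sum_empty, add_zero, sub_zero] at h1
    linarith [hV n, hM' n]
  have hbdd : BddBelow (range fun n =>
      V n + ∑ k ∈ Finset.range n, a k - ∑ k ∈ Finset.range n, e k) := by
    refine ⟨-M, ?_⟩
    rintro _ ⟨n, rfl⟩
    have := Finset.sum_nonneg fun k (_ : k ∈ Finset.range n) => ha k
    simp only
    linarith [hV n, hM' n]
  refine ⟨hsum, _, (((tendsto_atTop_ciInf hanti hbdd).sub hsum.hasSum.tendsto_sum_nat).add hl).congr
    fun n => ?_⟩
  ring

theorem norm_add_add_sq_le {E : Type*} [NormedAddCommGroup E] (a b c : E) :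
    ‖a + b + c‖ ^ 2 ≤ 3 * (‖a‖ ^ 2 + ‖b‖ ^ 2 + ‖c‖ ^ 2) := by
  have h := norm_add₃_le (a := a) (b := b) (c := c)
  have h0 := norm_nonneg (a + b + c)
  nlinarith [sq_nonneg (‖a‖ - ‖b‖), sq_nonneg (‖b‖ - ‖c‖), sq_nonneg (‖a‖ - ‖c‖)]

/-- The effect of one inexact gradient step on the squared distance to `z`; the gradient at `v` is
perturbed by `ε` and by the error `w`, and the cost is compared at a point `p` near `v`. -/
theorem gradient_step_le {E : Type*} [NormedAddCommGroup E] [InnerProductSpace ℝ E]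
    [CompleteSpace E] {f : E → ℝ} {f' : E → E} (hf : ConvexOn ℝ univ f)
    (hf' : ∀ x, HasGradientAt f (f' x) x) {v p z d w : E} {α ε B R Δ : ℝ} (hα : 0 ≤ α)
    (hvz : ‖v - z‖ ≤ R) (hBv : ‖f' v‖ ≤ B) (hBp : ‖f' p‖ ≤ B) (hd : ‖d - f' v‖ ≤ ε)
    (hvp : ‖v - p‖ ≤ Δ) :
    ‖v - α • (d + w) - z‖ ^ 2 ≤ ‖v - z‖ ^ 2 - 2 * α * (f p - f z) + 2 * α * (B * Δ)
      + 2 * R * (α * ε) - 2 * (α * inner ℝ w (v - z))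
      + 3 * α ^ 2 * (B ^ 2 + ε ^ 2 + ‖w‖ ^ 2) := by
  have hε : 0 ≤ ε := (norm_nonneg _).trans hd
  have hB : 0 ≤ B := (norm_nonneg _).trans hBv
  have h1 : ‖v - α • (d + w) - z‖ ^ 2
      = ‖v - z‖ ^ 2 - 2 * α * inner ℝ (d + w) (v - z) + α ^ 2 * ‖d + w‖ ^ 2 := by
    rw [sub_right_comm, norm_sub_sq_real, real_inner_smul_right, norm_smul, mul_pow,
      Real.norm_eq_abs, sq_abs, real_inner_comm]
    ring
  have h2 : inner ℝ (d + w) (v - z)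
      = inner ℝ (f' v) (v - z) + inner ℝ (d - f' v) (v - z) + inner ℝ w (v - z) := by
    rw [inner_add_left, inner_sub_left]; ring
  have h3 : f v - f z ≤ inner ℝ (f' v) (v - z) := by
    have := hf.add_inner_le (hf' v) z
    rw [← neg_sub v z, inner_neg_right] at this
    linarith
  -- A second use of convexity, now at p, moves the cost from v to p.
  have h4 : f p - B * Δ ≤ f v := by
    have h := hf.add_inner_le (hf' p) v
    have h' := (abs_le.1 (abs_real_inner_le_norm (f' p) (v - p))).1
    have : ‖f' p‖ * ‖v - p‖ ≤ B * Δ := by gcongr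
    linarith
  have h5 : - (ε * R) ≤ inner ℝ (d - f' v) (v - z) := by
    have h' := (abs_le.1 (abs_real_inner_le_norm (d - f' v) (v - z))).1
    have : ‖d - f' v‖ * ‖v - z‖ ≤ ε * R := by gcongr
    linarith
  have h6 : ‖d + w‖ ^ 2 ≤ 3 * (B ^ 2 + ε ^ 2 + ‖w‖ ^ 2) := by
    have h := norm_add_add_sq_le (f' v) (d - f' v) w
    rw [add_sub_cancel] at h
    have : ‖f' v‖ ^ 2 ≤ B ^ 2 := by gcongr
    have : ‖d - f' v‖ ^ 2 ≤ ε ^ 2 := by gcongr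
    linarith
  have h7 : α * (f p - f z - B * Δ - ε * R + inner ℝ w (v - z)) ≤ α * inner ℝ (d + w) (v - z) := by
    gcongr; linarith
  have h8 : α ^ 2 * ‖d + w‖ ^ 2 ≤ α ^ 2 * (3 * (B ^ 2 + ε ^ 2 + ‖w‖ ^ 2)) := by gcongr
  rw [h1]
  linarith

theorem frequently_lt_of_summable_mul {α b : ℕ → ℝ} (hα : ∀ k, 0 ≤ α k) (hdiv : ¬ Summable α)
    (h : Summable fun k => α k * b k) {ε : ℝ} (hε : 0 < ε) : ∃ᶠ k in atTop, b k < ε := by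
  intro hev
  refine hdiv (((summable_mul_left_iff hε.ne').1 ?_))
  obtain ⟨N, hN⟩ := eventually_atTop.1 hev
  refine (summable_nat_add_iff N).1 ?_
  refine Summable.of_nonneg_of_le (fun k => mul_nonneg hε.le (hα _)) (fun k => ?_)
    ((summable_nat_add_iff N).2 h)
  rw [mul_comm]
  exact mul_le_mul_of_nonneg_left (not_lt.1 (hN _ (Nat.le_add_left _ _))) (hα _)

/-- Convergence of distributed projected gradient descent along one trajectory, under summability
of the perturbations. -/
theorem exists_minimizer_tendsto {m n : ℕ} {f : Fin m → Euc n → ℝ} {f' : Fin m → Euc n → Euc n}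
    (hf : ∀ i, ConvexOn ℝ univ (f i)) (hf' : ∀ i x, HasGradientAt (f i) (f' i x) x)
    {X : Fin m → Set (Euc n)} (hXc : ∀ i, Convex ℝ (X i)) (hXk : ∀ i, IsCompact (X i))
    (hXint : (interior (⋂ i, X i)).Nonempty)
    {A : ℕ → Matrix (Fin m) (Fin m) ℝ} (hA : ∀ k, A k ∈ doublyStochastic ℝ (Fin m))
    {G : ℕ → SimpleGraph (Fin m)} (hG : ∀ k, (G k).Connected) {η : ℝ} (hη : 0 < η)
    (hpos : ∀ k i j, (j = i ∨ (G k).Adj j i) → η ≤ A k i j)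
    {α : ℕ → ℝ} (hα : ∀ k, 0 < α k) (hdiv : ¬ Summable α) (hα2 : Summable fun k => α k ^ 2)
    {x v d w : Fin m → ℕ → Euc n} {ε : Fin m → ℕ → ℝ} (hv : ∀ i k, v i k = ∑ j, A k i j • x j k)
    (hxX : ∀ i k, x i k ∈ X i)
    (hstep : ∀ i k, IsProjection (X i) (v i k - α k • (d i k + w i k)) (x i (k + 1)))
    (hd : ∀ i k, ‖d i k - f' i (v i k)‖ ≤ ε i k)
    (hε : ∀ i, Summable fun k => α k * ε i k) (hε2 : ∀ i, Summable fun k => α k ^ 2 * ε i k ^ 2)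
    (hw2 : ∀ i, Summable fun k => α k ^ 2 * ‖w i k‖ ^ 2)
    (hwv : ∀ i, SeriesConverges fun k => α k * inner ℝ (w i k) (v i k))
    (hwz : ∀ i z, SeriesConverges fun k => α k * inner ℝ (w i k) z) :
    ∃ z, (z ∈ ⋂ i, X i ∧ IsMinOn (fun y => ∑ i, f i y) (⋂ i, X i) z) ∧
      ∀ j, Tendsto (x j) atTop (𝓝 z) := by
  obtain ⟨i₀⟩ := (hG 0).nonempty
  have hm : 0 < (m : ℝ) := by exact_mod_cast i₀.pos
  set F : Euc n → ℝ := fun y => ∑ i, f i y with hF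
  have hFc : Continuous F := continuous_finsetSum _ fun i _ => (hf i).locallyLipschitz.continuous
  obtain ⟨c, hc⟩ := hXint
  obtain ⟨ρ, hρ, hcρ⟩ := Metric.nhds_basis_closedBall.mem_iff.1 (mem_interior_iff_mem_nhds.1 hc)
  have hXI : IsCompact (⋂ i, X i) :=
    (hXk i₀).of_isClosed_subset (isClosed_iInter fun i => (hXk i).isClosed) (iInter_subset _ _)
  obtain ⟨z₀, hz₀, hz₀min⟩ := hXI.exists_isMinOn ⟨c, interior_subset hc⟩ hFc.continuousOn
  obtain ⟨r, hr⟩ : ∃ r, ∀ i, ∀ y ∈ X i, ‖y‖ ≤ r := by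
    choose r hr using fun i => (hXk i).isBounded.exists_norm_le
    exact ⟨∑ i, |r i|, fun i y hy => (hr i y hy).trans ((le_abs_self _).trans
      (Finset.single_le_sum (f := fun i => |r i|) (fun _ _ => abs_nonneg _) (Finset.mem_univ i)))⟩
  have hrI : ∀ y ∈ ⋂ i, X i, ‖y‖ ≤ r := fun y hy => hr i₀ y (mem_iInter.1 hy i₀)
  have hr0 : 0 ≤ r := (norm_nonneg _).trans (hrI z₀ hz₀)
  obtain ⟨B, hB0, hB⟩ : ∃ B, 0 ≤ B ∧ ∀ i y, ‖y‖ ≤ r → ‖f' i y‖ ≤ B := by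
    choose B hB0 hB using fun i => (hf i).exists_bound_gradient (hf' i) r
    exact ⟨∑ i, B i, Finset.sum_nonneg fun i _ => hB0 i, fun i y hy => (hB i y hy).trans
      (Finset.single_le_sum (fun i _ => hB0 i) (Finset.mem_univ i))⟩
  have hvr : ∀ i k, ‖v i k‖ ≤ r := fun i k => by
    have h := (convex_closedBall (0 : Euc n) r).sum_mem (t := Finset.univ) (w := A k i)
      (z := fun j => x j k) (fun j _ => nonneg_of_mem_doublyStochastic (hA k))
      (sum_row_of_mem_doublyStochastic (hA k) i)
      (fun j _ => mem_closedBall_zero_iff.2 (hr j _ (hxX j k)))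
    rw [hv]
    exact mem_closedBall_zero_iff.1 h
  choose δ hδ0 hxx hvx hδS using fun k =>
    exists_disagreement (hA k) (hG k) hη (hpos k) (fun j => x j k)
  set κ : ℝ := η / (2 * (m : ℝ)) ^ 2 with hκ
  have hκ0 : 0 < κ := by positivity
  -- At most 2δ from any x_j or v_j to x_{i₀}, then 2r/ρ · δ from x_{i₀} to the feasible point p.
  set D : ℝ := 2 + 2 * r / ρ with hD
  have hD0 : 0 ≤ D := by positivity
  have hp : ∀ k, ∃ p ∈ ⋂ j, X j, ‖x i₀ k - p‖ ≤ 2 * r / ρ * δ k := fun k => by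
    obtain ⟨p, hp, hle⟩ := exists_mem_iInter_near (x := fun j => x j k) hXc hρ hcρ
      (fun j => hxX j k) (hδ0 k) (fun j => hxx k i₀ j)
    refine ⟨p, hp, hle.trans ?_⟩
    have : ‖x i₀ k - c‖ ≤ 2 * r := (norm_sub_le _ _).trans
      (by linarith [hr i₀ _ (hxX i₀ k), hrI c (interior_subset hc)])
    calc δ k / ρ * ‖x i₀ k - c‖ ≤ δ k / ρ * (2 * r) := by have := hδ0 k; gcongr
      _ = _ := by ring
  choose p hpX hpx using hp
  have hxp : ∀ j k, ‖x j k - p k‖ ≤ D * δ k := fun j k => by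
    have := norm_sub_le_norm_sub_add_norm_sub (x j k) (x i₀ k) (p k)
    have := hxx k j i₀
    have := hpx k
    have := hδ0 k
    rw [hD, add_mul]; linarith
  have hvp : ∀ j k, ‖v j k - p k‖ ≤ D * δ k := fun j k => by
    have := norm_sub_le_norm_sub_add_norm_sub (v j k) (x i₀ k) (p k)
    have h1 := hvx k j i₀
    rw [← hv] at h1
    have := hpx k
    rw [hD, add_mul]; linarith
  -- The first term is the remainder of the completed square in `h5`; the second collects 3B² from
  -- the squared gradients of m agents.
  set C : ℝ := 2 / κ * (m * (B * D)) ^ 2 + 3 * m * B ^ 2 with hC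
  have hdesc : ∀ z ∈ ⋂ i, X i, ∀ k, ∑ j, ‖x j (k + 1) - z‖ ^ 2 ≤ ∑ j, ‖x j k - z‖ ^ 2
      - (κ / 2 * δ k ^ 2 + 2 * (α k * (F (p k) - F z)))
      + (C * α k ^ 2 + ∑ i, (4 * r * (α k * ε i k) + 3 * (α k ^ 2 * ε i k ^ 2)
        + 3 * (α k ^ 2 * ‖w i k‖ ^ 2) + (-2) * (α k * inner ℝ (w i k) (v i k))
        + 2 * (α k * inner ℝ (w i k) z))) := by
    intro z hz k
    have h1 : ∀ i, ‖x i (k + 1) - z‖ ^ 2 ≤ ‖v i k - z‖ ^ 2 - 2 * α k * (f i (p k) - f i z)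
        + (2 * α k * (B * (D * δ k)) + 3 * α k ^ 2 * B ^ 2)
        + (4 * r * (α k * ε i k) + 3 * (α k ^ 2 * ε i k ^ 2)
        + 3 * (α k ^ 2 * ‖w i k‖ ^ 2) + (-2) * (α k * inner ℝ (w i k) (v i k))
        + 2 * (α k * inner ℝ (w i k) z)) := fun i => by
      refine ((hstep i k).dist_sq_le (hXc i) (mem_iInter.1 hz i)).trans ?_
      refine (gradient_step_le (hf i) (hf' i) (hα k).le (R := 2 * r) (B := B)
        ((norm_sub_le _ _).trans (by linarith [hvr i k, hrI z hz])) (hB i _ (hvr i k))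
        (hB i _ (hrI _ (hpX k))) (hd i k) (hvp i k)).trans ?_
      rw [inner_sub_right]
      linarith
    have h2 := Finset.sum_le_sum fun i (_ : i ∈ Finset.univ) => h1 i
    simp only [Finset.sum_add_distrib (f := fun i => _ - _), Finset.sum_add_distrib (g := fun i =>
      4 * r * (α k * ε i k) + 3 * (α k ^ 2 * ε i k ^ 2)
        + 3 * (α k ^ 2 * ‖w i k‖ ^ 2) + (-2) * (α k * inner ℝ (w i k) (v i k))
        + 2 * (α k * inner ℝ (w i k) z)), Finset.sum_sub_distrib (f := fun i => ‖v i k - z‖ ^ 2),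
      ← Finset.mul_sum Finset.univ _ (2 * α k), Finset.sum_const, Finset.card_univ,
      Fintype.card_fin, nsmul_eq_mul] at h2
    rw [Finset.sum_sub_distrib] at h2
    have h3 := sum_average_norm_sq (hA k) (fun j => x j k) z
    have h4 := hδS k
    simp only [← hv] at h3 h4
    have h5 : 2 * α k * (m * (B * D)) * δ k
        ≤ κ / 2 * δ k ^ 2 + 2 / κ * (m * (B * D)) ^ 2 * α k ^ 2 := by
      have : κ / 2 * δ k ^ 2 + 2 / κ * (m * (B * D)) ^ 2 * α k ^ 2
          - 2 * α k * (m * (B * D)) * δ k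
          = κ / 2 * (δ k - 2 / κ * (m * (B * D)) * α k) ^ 2 := by field_simp; ring
      have : 0 ≤ κ / 2 * (δ k - 2 / κ * (m * (B * D)) * α k) ^ 2 := by positivity
      linarith
    rw [hC]
    simp only [hF]
    linarith
  have hconv : ∀ z ∈ ⋂ i, X i, IsMinOn F (⋂ i, X i) z →
      (Summable fun k => κ / 2 * δ k ^ 2 + 2 * (α k * (F (p k) - F z))) ∧
        ∃ l, Tendsto (fun k => ∑ j, ‖x j k - z‖ ^ 2) atTop (𝓝 l) := by
    intro z hz hmin
    refine summable_and_tendsto_of_descent (fun k => by positivity) (fun k => ?_) ?_ (hdesc z hz)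
    · have : 0 ≤ F (p k) - F z := sub_nonneg.2 (hmin (hpX k))
      have := hα k
      positivity
    · refine (hα2.seriesConverges.const_mul C).add (SeriesConverges.sum fun i _ => ?_)
      exact (((((hε i).seriesConverges.const_mul _).add ((hε2 i).seriesConverges.const_mul _)).add
        ((hw2 i).seriesConverges.const_mul _)).add ((hwv i).const_mul _)).add ((hwz i z).const_mul _)
  have hsum := (hconv z₀ hz₀ hz₀min).1
  have hgap : ∀ k, 0 ≤ F (p k) - F z₀ := fun k => sub_nonneg.2 (hz₀min (hpX k))
  have hδsq : Tendsto (fun k => κ / 2 * δ k ^ 2) atTop (𝓝 0) :=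
    (Summable.of_nonneg_of_le (fun k => by positivity) (fun k => le_add_of_nonneg_right
      (mul_nonneg zero_le_two (mul_nonneg (hα k).le (hgap k)))) hsum).tendsto_atTop_zero
  have hδ : Tendsto δ atTop (𝓝 0) := by
    have h := (hδsq.const_mul (2 / κ)).sqrt
    simp only [mul_zero, Real.sqrt_zero] at h
    refine h.congr fun k => ?_
    rw [← mul_assoc, div_mul_div_cancel₀ hκ0.ne', div_self two_ne_zero, one_mul,
      Real.sqrt_sq (hδ0 k)]
  have hFsum : Summable fun k => α k * (F (p k) - F z₀) :=
    Summable.of_nonneg_of_le (fun k => mul_nonneg (hα k).le (hgap k)) (fun k => by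
      have := mul_nonneg (hα k).le (hgap k)
      have : 0 ≤ κ / 2 * δ k ^ 2 := by positivity
      linarith) hsum
  -- As α is not summable, the gap F(p) - F(z₀) is infinitely often below each 1/(n+1).
  obtain ⟨s, hs, hslt⟩ := extraction_forall_of_frequently
    (P := fun (n : ℕ) k => F (p k) - F z₀ < 1 / ((n : ℝ) + 1)) fun n =>
      frequently_lt_of_summable_mul (fun k => (hα k).le) hdiv hFsum (by positivity)
  obtain ⟨z, hz, t, ht, hpz⟩ := hXI.tendsto_subseq fun k => hpX (s k)
  have hst : Tendsto (s ∘ t) atTop atTop := hs.tendsto_atTop.comp ht.tendsto_atTop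
  have hFz : F z - F z₀ ≤ 0 :=
    le_of_tendsto_of_tendsto' (((hFc.tendsto z).comp hpz).sub_const _)
      (tendsto_one_div_add_atTop_nhds_zero_nat.comp ht.tendsto_atTop) fun k => (hslt (t k)).le
  have hzmin : IsMinOn F (⋂ i, X i) z := fun y hy => (sub_nonpos.1 hFz).trans (hz₀min hy)
  -- The descent holds for every minimizer, so it applies to the cluster point just found.
  obtain ⟨l, hl⟩ := (hconv z hz hzmin).2
  have hsub : ∀ j, Tendsto (fun k => x j (s (t k))) atTop (𝓝 z) := fun j => by
    have h0 : Tendsto (fun k => x j (s (t k)) - p (s (t k))) atTop (𝓝 0) := by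
      refine squeeze_zero_norm (fun k => hxp j (s (t k))) ?_
      simpa using (hδ.comp hst).const_mul D
    simpa using h0.add hpz
  have hl0 : l = 0 := by
    refine tendsto_nhds_unique (hl.comp hst) ?_
    have : Tendsto (fun k => ∑ j, ‖x j (s (t k)) - z‖ ^ 2) atTop (𝓝 (∑ j : Fin m, ‖z - z‖ ^ 2)) :=
      tendsto_finsetSum _ fun j _ => ((hsub j).sub_const z).norm.pow 2
    simpa [Function.comp_def] using this
  refine ⟨z, ⟨hz, hzmin⟩, fun j => ?_⟩
  rw [tendsto_iff_norm_sub_tendsto_zero]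
  rw [hl0] at hl
  have h := hl.sqrt
  rw [Real.sqrt_zero] at h
  refine squeeze_zero (fun k => norm_nonneg _) (fun k => Real.le_sqrt_of_sq_le ?_) h
  exact Finset.single_le_sum (f := fun j => ‖x j k - z‖ ^ 2) (fun _ _ => by positivity)
    (Finset.mem_univ j)

/-- Each directional derivative is a pointwise limit of measurable difference quotients, and the
coordinates of the gradient are such derivatives. -/
theorem measurable_of_hasGradientAt {n : ℕ} {Ω : Type*} [MeasurableSpace Ω] {F : Ω → Euc n → ℝ}
    {y D : Ω → Euc n} (hD : ∀ ω, HasGradientAt (F ω) (D ω) (y ω))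
    (hF : ∀ u, Measurable fun ω => F ω (y ω + u)) : Measurable D := by
  have hcoord : ∀ e : Euc n, Measurable fun ω => inner ℝ (D ω) e := fun e => by
    refine measurable_of_tendsto_metrizable (f := fun (k : ℕ) ω =>
      ((k : ℝ) + 1) • (F ω (y ω + (1 / ((k : ℝ) + 1)) • e) - F ω (y ω)))
      (fun k => ?_) (tendsto_pi_nhds.2 fun ω => ?_)
    · have h0 := hF 0
      simp only [add_zero] at h0
      exact ((hF _).sub h0).const_smul ((k : ℝ) + 1)
    · have hd0 : Tendsto (fun k : ℕ => (1 / ((k : ℝ) + 1)) • e) atTop (𝓝 0) := by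
        simpa using (tendsto_one_div_add_atTop_nhds_zero_nat (𝕜 := ℝ)).smul_const e
      have h := (hasGradientWithinAt_univ.2 (hD ω)).hasFDerivWithinAt.lim
        (c := fun k : ℕ => (k : ℝ) + 1) (v := e) hd0
        (Eventually.of_forall fun _ => mem_univ _) (tendsto_const_nhds.congr fun k => by
          rw [smul_smul, mul_one_div_cancel (by positivity), one_smul])
      rwa [InnerProductSpace.toDual_apply_apply] at h
  have hpi : Measurable fun ω => (D ω).ofLp := measurable_pi_iff.2 fun l => by
    simpa [EuclideanSpace.inner_single_right] using hcoord (EuclideanSpace.single l 1)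
  exact (MeasurableEquiv.toLp 2 (Fin n → ℝ)).measurable.comp hpi

/-! ### Random series and martingale differences -/

section Probability

variable {Ω : Type*} {mΩ : MeasurableSpace Ω} {P : Measure Ω}

theorem integrable_inner_of_sq {E : Type*} [NormedAddCommGroup E] [InnerProductSpace ℝ E]
    {Y W : Ω → E} (hY : AEStronglyMeasurable Y P) (hW : AEStronglyMeasurable W P)
    (hY2 : Integrable (fun ω => ‖Y ω‖ ^ 2) P) (hW2 : Integrable (fun ω => ‖W ω‖ ^ 2) P) :
    Integrable (fun ω => inner ℝ (Y ω) (W ω)) P := by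
  refine (hY2.add hW2).mono' (hY.inner hW) (Eventually.of_forall fun ω => ?_)
  have := norm_inner_le_norm (𝕜 := ℝ) (Y ω) (W ω)
  simp only [Pi.add_apply]
  nlinarith [sq_nonneg (‖Y ω‖ - ‖W ω‖), sq_nonneg (‖Y ω‖), sq_nonneg (‖W ω‖)]

theorem condExp_inner_eq_zero {E : Type*} [NormedAddCommGroup E] [InnerProductSpace ℝ E]
    [CompleteSpace E] {m : MeasurableSpace Ω} {Y W : Ω → E} (hY : StronglyMeasurable[m] Y)
    (hW : Integrable W P) (hYW : Integrable (fun ω => inner ℝ (Y ω) (W ω)) P)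
    (h0 : P[W | m] =ᵐ[P] 0) : P[fun ω => inner ℝ (Y ω) (W ω) | m] =ᵐ[P] 0 := by
  filter_upwards [condExp_bilin_of_stronglyMeasurable_left (innerSL ℝ) hY hYW hW, h0] with ω h1 h2
  refine h1.trans ?_
  rw [h2]
  simp

/-- By Tonelli the sum has finite integral, hence is finite almost everywhere. -/
theorem ae_summable_of_summable_integral {f : ℕ → Ω → ℝ} (h0 : ∀ k ω, 0 ≤ f k ω)
    (hf : ∀ k, Integrable (f k) P) (hs : Summable fun k => ∫ ω, f k ω ∂P) :
    ∀ᵐ ω ∂P, Summable fun k => f k ω := by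
  have hm : ∀ k, AEMeasurable (fun ω => ENNReal.ofReal (f k ω)) P := fun k =>
    (hf k).aemeasurable.ennreal_ofReal
  have hfin : ∫⁻ ω, ∑' k, ENNReal.ofReal (f k ω) ∂P ≠ ⊤ := by
    rw [lintegral_tsum hm]
    simp_rw [← ofReal_integral_eq_lintegral_ofReal (hf _) (Eventually.of_forall (h0 _))]
    exact hs.tsum_ofReal_ne_top
  filter_upwards [ae_lt_top' (AEMeasurable.tsum hm) hfin] with ω hω
  have h := ENNReal.summable_toReal hω.ne
  simpa only [ENNReal.toReal_ofReal (h0 _ _)] using h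

variable [IsProbabilityMeasure P]

theorem integral_eq_zero_of_condExp_eq_zero {m : MeasurableSpace Ω} (hm : m ≤ mΩ) {f : Ω → ℝ}
    (h0 : P[f | m] =ᵐ[P] 0) : ∫ ω, f ω ∂P = 0 := by
  rw [← integral_condExp hm, integral_congr_ae h0]
  simp

theorem integral_le_of_condExp_le {m : MeasurableSpace Ω} (hm : m ≤ mΩ) {f : Ω → ℝ} {c : ℝ}
    (h : P[f | m] ≤ᵐ[P] fun _ => c) : ∫ ω, f ω ∂P ≤ c := by
  rw [← integral_condExp hm]
  simpa using integral_mono_ae integrable_condExp (integrable_const c) h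

/-- A series of square integrable martingale differences converges almost surely if the sum of
their variances is finite. -/
theorem ae_seriesConverges_of_martingale_difference {ℱ : Filtration ℕ mΩ} {d : ℕ → Ω → ℝ}
    (hd : ∀ k, StronglyMeasurable[ℱ (k + 1)] (d k)) (hL2 : ∀ k, MemLp (d k) 2 P)
    (h0 : ∀ k, P[d k | ℱ k] =ᵐ[P] 0) (hs : Summable fun k => ∫ ω, d k ω ^ 2 ∂P) :
    ∀ᵐ ω ∂P, SeriesConverges fun k => d k ω := by
  set M : ℕ → Ω → ℝ := fun n ω => ∑ k ∈ Finset.range n, d k ω with hM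
  have hadp : ∀ n, StronglyMeasurable[ℱ n] (M n) := fun n =>
    Finset.stronglyMeasurable_fun_sum _ fun k hk =>
      (hd k).mono (ℱ.mono (Finset.mem_range.1 hk))
  have hML2 : ∀ n, MemLp (M n) 2 P := fun n => memLp_finsetSum _ fun k _ => hL2 k
  have hint : ∀ n, Integrable (M n) P := fun n => (hML2 n).integrable one_le_two
  have hsucc : ∀ n, M (n + 1) = fun ω => M n ω + d n ω := fun n => by
    funext ω
    simp only [hM, Finset.sum_range_succ]
  have hmart : Martingale M ℱ P := by
    refine martingale_of_condExp_sub_eq_zero_nat hadp hint fun n => ?_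
    have : M (n + 1) - M n = d n := by
      funext ω
      rw [hsucc]
      simp
    rw [this]
    exact h0 n
  -- Martingale increments are orthogonal, so second moments add.
  have hsq : ∀ n, ∫ ω, M n ω ^ 2 ∂P = ∑ k ∈ Finset.range n, ∫ ω, d k ω ^ 2 ∂P := by
    intro n
    induction n with
    | zero => simp [hM]
    | succ n ih =>
      have hMd : Integrable (fun ω => M n ω * d n ω) P := (hML2 n).integrable_mul (hL2 n)
      have hcross : ∫ ω, M n ω * d n ω ∂P = 0 := by
        refine integral_eq_zero_of_condExp_eq_zero (ℱ.le n) ?_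
        filter_upwards [condExp_bilin_of_stronglyMeasurable_left (ContinuousLinearMap.mul ℝ ℝ)
          (hadp n) hMd ((hL2 n).integrable one_le_two), h0 n] with ω h1 h2
        refine h1.trans ?_
        rw [h2]
        simp
      have hexp : ∀ ω, M (n + 1) ω ^ 2 = M n ω ^ 2 + 2 * (M n ω * d n ω) + d n ω ^ 2 := fun ω => by
        rw [hsucc]; ring
      simp_rw [hexp]
      have h12 : Integrable (fun ω => M n ω ^ 2 + 2 * (M n ω * d n ω)) P :=
        (hML2 n).integrable_sq.add (hMd.const_mul 2)
      rw [integral_add h12 (hL2 n).integrable_sq, integral_add (hML2 n).integrable_sq (hMd.const_mul 2), integral_const_mul, hcross,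
        Finset.sum_range_succ, ih]
      ring
  -- Martingale convergence needs an L¹ bound; |M| ≤ 1 + M² supplies it from the second moments.
  have hbdd : ∀ n, eLpNorm (M n) 1 P ≤ ((1 + ∑' k, ∫ ω, d k ω ^ 2 ∂P).toNNReal : ENNReal) := by
    intro n
    rw [eLpNorm_one_eq_lintegral_enorm, ← ofReal_integral_norm_eq_lintegral_enorm (hint n)]
    refine ENNReal.ofReal_le_ofReal ?_
    calc ∫ ω, ‖M n ω‖ ∂P ≤ ∫ ω, (1 + M n ω ^ 2) ∂P := by
          refine integral_mono (hint n).norm ((integrable_const 1).add (hML2 n).integrable_sq)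
            fun ω => ?_
          simp only [Real.norm_eq_abs, ← sq_abs (M n ω)]
          nlinarith [sq_nonneg (|M n ω| - 1)]
      _ = 1 + ∑ k ∈ Finset.range n, ∫ ω, d k ω ^ 2 ∂P := by
          rw [integral_add (integrable_const 1) (hML2 n).integrable_sq, hsq]
          simp
      _ ≤ _ := by
          gcongr
          exact hs.sum_le_tsum _ fun k _ => integral_nonneg fun ω => sq_nonneg _
  filter_upwards [hmart.submartingale.exists_ae_tendsto_of_bdd hbdd] with ω hω
  exact hω

/-- The series `∑ k, α k ⟨w k, u k⟩` of martingale differences, for adapted bounded `u`, converges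
almost surely. -/
theorem ae_seriesConverges_inner {E : Type*} [NormedAddCommGroup E] [InnerProductSpace ℝ E]
    [CompleteSpace E] {ℱ : Filtration ℕ mΩ} {w u : ℕ → Ω → E} {α : ℕ → ℝ}
    (hw : ∀ k, StronglyMeasurable[ℱ (k + 1)] (w k)) (hwi : ∀ k, Integrable (w k) P)
    (hw2 : ∀ k, Integrable (fun ω => ‖w k ω‖ ^ 2) P) (hw0 : ∀ k, P[w k | ℱ k] =ᵐ[P] 0)
    {ν : ℝ} (hν : ∀ k, ∫ ω, ‖w k ω‖ ^ 2 ∂P ≤ ν) (hα : Summable fun k => α k ^ 2)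
    (hu : ∀ k, StronglyMeasurable[ℱ k] (u k)) {r : ℝ} (hur : ∀ k ω, ‖u k ω‖ ≤ r) :
    ∀ᵐ ω ∂P, SeriesConverges fun k => α k * inner ℝ (w k ω) (u k ω) := by
  have hle : ∀ k ω, (α k * inner ℝ (w k ω) (u k ω)) ^ 2 ≤ α k ^ 2 * r ^ 2 * ‖w k ω‖ ^ 2 := by
    intro k ω
    have h : |inner ℝ (w k ω) (u k ω)| ≤ ‖w k ω‖ * r :=
      (abs_real_inner_le_norm _ _).trans (by gcongr; exact hur k ω)
    have h2 : inner ℝ (w k ω) (u k ω) ^ 2 ≤ (‖w k ω‖ * r) ^ 2 := by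
      rw [← sq_abs]; gcongr
    rw [mul_pow]
    calc _ ≤ α k ^ 2 * (‖w k ω‖ * r) ^ 2 := by gcongr
      _ = _ := by ring
  have hmeas : ∀ k, StronglyMeasurable[ℱ (k + 1)] fun ω => α k * inner ℝ (w k ω) (u k ω) :=
    fun k => ((hw k).inner ((hu k).mono (ℱ.mono k.le_succ))).const_mul _
  have hL2 : ∀ k, MemLp (fun ω => α k * inner ℝ (w k ω) (u k ω)) 2 P := fun k => by
    have hm := ((hmeas k).mono (ℱ.le _)).aestronglyMeasurable (μ := P)
    rw [memLp_two_iff_integrable_sq hm]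
    refine ((hw2 k).const_mul (α k ^ 2 * r ^ 2)).mono' (hm.pow 2) (Eventually.of_forall fun ω => ?_)
    rw [Real.norm_eq_abs, abs_of_nonneg (sq_nonneg _)]
    exact hle k ω
  refine ae_seriesConverges_of_martingale_difference hmeas hL2 (fun k => ?_) ?_
  · have hcomm : ∀ ω, inner ℝ (α k • u k ω) (w k ω) = α k * inner ℝ (w k ω) (u k ω) := fun ω => by
      rw [real_inner_smul_left, real_inner_comm]
    have hint : Integrable (fun ω => inner ℝ (α k • u k ω) (w k ω)) P :=
      ((hL2 k).integrable one_le_two).congr (Eventually.of_forall fun ω => (hcomm ω).symm)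
    exact (condExp_congr_ae (Eventually.of_forall fun ω => (hcomm ω).symm)).trans
      (condExp_inner_eq_zero ((hu k).const_smul (α k)) (hwi k) hint (hw0 k))
  · refine Summable.of_nonneg_of_le (fun k => integral_nonneg fun ω => sq_nonneg _) (fun k => ?_)
      (hα.mul_right (r ^ 2 * ν))
    calc _ ≤ ∫ ω, α k ^ 2 * r ^ 2 * ‖w k ω‖ ^ 2 ∂P :=
          integral_mono (hL2 k).integrable_sq ((hw2 k).const_mul _) (hle k)
      _ = α k ^ 2 * r ^ 2 * ∫ ω, ‖w k ω‖ ^ 2 ∂P := integral_const_mul _ _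
      _ ≤ α k ^ 2 * r ^ 2 * ν := by gcongr; exact hν k
      _ = _ := by ring

end Probability

/-- Since γ → 0, eventually aγ < κ/2, so half of the drift absorbs the quadratic term and the tail
satisfies the descent lemma. -/
theorem summable_mul_of_contraction {γ U : ℕ → ℝ} {κ a c : ℝ} (hκ : 0 < κ)
    (hγ : ∀ k, 0 < γ k) (hγ2 : Summable fun k => γ k ^ 2) (hU : ∀ k, 0 ≤ U k)
    (h : ∀ k, U (k + 1) ≤ U k - κ * γ k * U k + a * γ k ^ 2 * U k + c * γ k ^ 2) :
    Summable fun k => γ k * U k := by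
  have hγ0 : Tendsto γ atTop (𝓝 0) := by
    have h := hγ2.tendsto_atTop_zero.sqrt
    rw [Real.sqrt_zero] at h
    exact h.congr fun k => Real.sqrt_sq (hγ k).le
  have hev : ∀ᶠ k in atTop, a * γ k < κ / 2 := by
    have := hγ0.const_mul a
    rw [mul_zero] at this
    exact this.eventually_lt_const (by positivity)
  obtain ⟨N, hN⟩ := eventually_atTop.1 hev
  have hs := (summable_and_tendsto_of_descent (V := fun k => U (k + N))
    (a := fun k => κ / 2 * (γ (k + N) * U (k + N))) (e := fun k => c * γ (k + N) ^ 2)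
    (fun k => hU _) (fun k => by have := hU (k + N); have := hγ (k + N); positivity)
    (((summable_nat_add_iff N).2 hγ2).mul_left c).seriesConverges fun k => by
      have h1 := h (k + N)
      have h2 : a * γ (k + N) * (γ (k + N) * U (k + N)) ≤ κ / 2 * (γ (k + N) * U (k + N)) :=
        mul_le_mul_of_nonneg_right (hN _ (Nat.le_add_left _ _)).le
          (mul_nonneg (hγ _).le (hU _))
      rw [Nat.add_right_comm]
      linarith).1
  exact (summable_nat_add_iff N).1 ((summable_mul_left_iff (by positivity)).1 hs)

/-! ### Measurability of the iterates -/

section Measurability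

variable {Ω : Type*}

theorem measurable_gradient_comp {n p d : ℕ} [MeasurableSpace Ω] {ψ : Euc n → Euc p → Euc d → ℝ}
    {Θ : Set (Euc p)} (hψ : Measurable fun q : Euc n × Euc p × Euc d => ψ q.1 q.2.1 q.2.2)
    (hdiff : ∀ θ ∈ Θ, ∀ s, ContDiff ℝ 1 fun x => ψ x θ s) {v : Ω → Euc n} {θ : Ω → Euc p}
    {ζ : Ω → Euc d} (hv : Measurable v) (hθ : Measurable θ) (hζ : Measurable ζ)
    (hmem : ∀ ω, θ ω ∈ Θ) : Measurable fun ω => gradient (fun y => ψ y (θ ω) (ζ ω)) (v ω) :=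
  measurable_of_hasGradientAt (F := fun ω y => ψ y (θ ω) (ζ ω)) (y := v)
    (fun ω => (((hdiff _ (hmem ω) (ζ ω)).differentiable one_ne_zero) (v ω)).hasGradientAt)
    fun u => hψ.comp ((hv.add_const u).prodMk (hθ.prodMk hζ))

theorem measurable_localGrad_comp {m n p d : ℕ} [MeasurableSpace Ω]
    {φ : Fin m → Euc n → Euc p → Euc d → ℝ} {μ : Measure (Euc d)} [SFinite μ] {Θ : Set (Euc p)}
    {i : Fin m} (hφ : Measurable fun q : Euc n × Euc p × Euc d => φ i q.1 q.2.1 q.2.2)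
    (hgrad : ∀ x, ∀ θ ∈ Θ, HasGradientAt (fun y => localCost φ μ i y θ) (localGrad φ μ i x θ) x)
    {v : Ω → Euc n} {θ : Ω → Euc p} (hv : Measurable v) (hθ : Measurable θ)
    (hmem : ∀ ω, θ ω ∈ Θ) : Measurable fun ω => localGrad φ μ i (v ω) (θ ω) := by
  have hcost : Measurable fun q : Euc n × Euc p => localCost φ μ i q.1 q.2 := by
    have h : Measurable fun q : (Euc n × Euc p) × Euc d => φ i q.1.1 q.1.2 q.2 :=
      hφ.comp (measurable_fst.fst.prodMk (measurable_fst.snd.prodMk measurable_snd))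
    exact h.stronglyMeasurable.integral_prod_right.measurable
  exact measurable_of_hasGradientAt (F := fun ω y => localCost φ μ i y (θ ω)) (y := v)
    (fun ω => hgrad _ _ (hmem ω)) fun u => hcost.comp ((hv.add_const u).prodMk hθ)

theorem measurable_average {m n : ℕ} [MeasurableSpace Ω] {A : ℕ → Matrix (Fin m) (Fin m) ℝ}
    {x : Fin m → ℕ → Ω → Euc n} {k : ℕ} (hx : ∀ j, Measurable (x j k)) (i : Fin m) :
    Measurable (average A x i k) :=
  Finset.measurable_sum _ fun j _ => (hx j).const_smul (A k i j)

variable {m n p d r : ℕ} {x : Fin m → ℕ → Ω → Euc n} {θ : Fin m → ℕ → Ω → Euc p}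
  {ξ : Fin m → ℕ → Ω → Euc d} {χ : Fin m → ℕ → Ω → Euc r}

theorem history_mono {k l : ℕ} (hkl : k ≤ l) : history x θ ξ χ k ≤ history x θ ξ χ l := by
  unfold history
  refine sup_le_sup_left (iSup_mono fun i => iSup_mono fun t => ?_) _
  exact iSup_le fun h => le_iSup_of_le (h.trans_le hkl) le_rfl

theorem history_le [mΩ : MeasurableSpace Ω] (hx : ∀ i, Measurable (x i 0))
    (hθ : ∀ i, Measurable (θ i 0)) (hξ : ∀ i k, Measurable (ξ i k))
    (hχ : ∀ i k, Measurable (χ i k)) (k : ℕ) : history x θ ξ χ k ≤ mΩ :=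
  sup_le (iSup_le fun i => sup_le (hx i).comap_le (hθ i).comap_le)
    (iSup_le fun i => iSup_le fun t => iSup_le fun _ => sup_le (hξ i t).comap_le (hχ i t).comap_le)

theorem measurable_initial (i : Fin m) (k : ℕ) :
    Measurable[history x θ ξ χ k] (x i 0) ∧ Measurable[history x θ ξ χ k] (θ i 0) := by
  have h : MeasurableSpace.comap (x i 0) inferInstance ⊔ MeasurableSpace.comap (θ i 0) inferInstance
      ≤ history x θ ξ χ k := le_sup_of_le_left (le_iSup_of_le i le_rfl)
  exact ⟨measurable_iff_comap_le.2 (le_sup_left.trans h),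
    measurable_iff_comap_le.2 (le_sup_right.trans h)⟩

theorem measurable_samples (i : Fin m) {t k : ℕ} (htk : t < k) :
    Measurable[history x θ ξ χ k] (ξ i t) ∧ Measurable[history x θ ξ χ k] (χ i t) := by
  have h : MeasurableSpace.comap (ξ i t) inferInstance ⊔ MeasurableSpace.comap (χ i t) inferInstance
      ≤ history x θ ξ χ k :=
    le_sup_of_le_right (le_iSup_of_le i (le_iSup_of_le t (le_iSup_of_le htk le_rfl)))
  exact ⟨measurable_iff_comap_le.2 (le_sup_left.trans h),
    measurable_iff_comap_le.2 (le_sup_right.trans h)⟩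

theorem measurable_projected {C : Set (Euc n)} (hC : Convex ℝ C) (hcl : IsClosed C)
    [MeasurableSpace Ω] {u q : Ω → Euc n} (hu : Measurable u)
    (h : ∀ ω, IsProjection C (u ω) (q ω)) : Measurable q := by
  rcases isEmpty_or_nonempty Ω with h0 | ⟨⟨ω₀⟩⟩
  · exact measurable_of_empty q
  obtain ⟨π, hπ, heq⟩ := exists_continuous_projection ⟨_, (h ω₀).1⟩ hC hcl
  have : q = π ∘ u := funext fun ω => heq _ _ (h ω)
  rw [this]
  exact hπ.measurable.comp hu

/-- The iterates at time `k` are functions of the history up to time `k`. -/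
theorem measurable_iterates {X : Fin m → Set (Euc n)} {Θ : Set (Euc p)}
    {φ : Fin m → Euc n → Euc p → Euc d → ℝ} {g : Euc p → Euc r → ℝ}
    {A : ℕ → Matrix (Fin m) (Fin m) ℝ} {α γ : ℕ → ℝ}
    (hφ : ∀ i, Measurable fun q : Euc n × Euc p × Euc d => φ i q.1 q.2.1 q.2.2)
    (hφ_diff : ∀ i, ∀ θ ∈ Θ, ∀ s, ContDiff ℝ 1 fun x => φ i x θ s)
    (hg : Measurable fun q : Euc p × Euc r => g q.1 q.2)
    (hg_diff : ∀ c, ContDiff ℝ 1 fun θ => g θ c)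
    (hX_convex : ∀ i, Convex ℝ (X i)) (hX_closed : ∀ i, IsClosed (X i))
    (hΘ_convex : Convex ℝ Θ) (hΘ_closed : IsClosed Θ) (hθ_mem : ∀ i k ω, θ i k ω ∈ Θ)
    (hx_step : ∀ i k ω, IsProjection (X i) (average A x i k ω
      - α k • gradient (fun y => φ i y (θ i k ω) (ξ i k ω)) (average A x i k ω)) (x i (k + 1) ω))
    (hθ_step : ∀ i k ω, IsProjection Θ
      (θ i k ω - γ k • gradient (fun t => g t (χ i k ω)) (θ i k ω)) (θ i (k + 1) ω)) (k : ℕ) :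
    (∀ i, Measurable[history x θ ξ χ k] (x i k)) ∧
      ∀ i, Measurable[history x θ ξ χ k] (θ i k) := by
  induction k with
  | zero => exact ⟨fun i => (measurable_initial i 0).1, fun i => (measurable_initial i 0).2⟩
  | succ k ih =>
    let _ : MeasurableSpace Ω := history x θ ξ χ (k + 1)
    have hle : history x θ ξ χ k ≤ history x θ ξ χ (k + 1) := history_mono k.le_succ
    have hx : ∀ i, Measurable (x i k) := fun i => (ih.1 i).mono hle le_rfl
    have hθ : ∀ i, Measurable (θ i k) := fun i => (ih.2 i).mono hle le_rfl
    have hξ : ∀ i, Measurable (ξ i k) := fun i => (measurable_samples i k.lt_succ_self).1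
    have hχ : ∀ i, Measurable (χ i k) := fun i => (measurable_samples i k.lt_succ_self).2
    have hv := measurable_average (A := A) hx
    refine ⟨fun i => measurable_projected (hX_convex i) (hX_closed i) ?_ (hx_step i k),
      fun i => measurable_projected hΘ_convex hΘ_closed ?_ (hθ_step i k)⟩
    · exact (hv i).sub ((measurable_gradient_comp (hφ i) (hφ_diff i) (hv i) (hθ i) (hξ i)
        (hθ_mem i k)).const_smul (α k))
    · refine (hθ i).sub (Measurable.const_smul ?_ (γ k))
      -- A dummy parameter in `Euc 0` brings g into the three-argument form.
      exact measurable_gradient_comp (ψ := fun t (_ : Euc 0) c => g t c) (Θ := univ)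
        (θ := fun _ => 0) (hg.comp (measurable_fst.prodMk measurable_snd.snd))
        (fun _ _ c => hg_diff c) (hθ i) measurable_const (hχ i) fun _ => mem_univ _

end Measurability

/-! ### The learning error -/

/-- Mean square error of projected stochastic gradient descent for a strongly convex function. -/
theorem summable_stochastic_gradient {p : ℕ} {Ω : Type*} {mΩ : MeasurableSpace Ω} {P : Measure Ω}
    [IsProbabilityMeasure P] {ℱ : ℕ → MeasurableSpace Ω} (hℱ : ∀ k, ℱ k ≤ mΩ) {Θ : Set (Euc p)}
    (hΘ : Convex ℝ Θ) {h : Euc p → ℝ} {H : Euc p → Euc p} {κ R : ℝ} (hκ : 0 < κ)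
    (hconv : StrongConvexOn Θ κ h) (hgrad : ∀ θ ∈ Θ, HasGradientWithinAt h (H θ) Θ θ)
    (hlip : ∀ θ ∈ Θ, ∀ θ' ∈ Θ, ‖H θ - H θ'‖ ≤ R * ‖θ - θ'‖) {s : Euc p} (hs : s ∈ Θ)
    (hmin : IsMinOn h Θ s) {γ : ℕ → ℝ} (hγ : ∀ k, 0 < γ k) (hγ2 : Summable fun k => γ k ^ 2)
    {θ β : ℕ → Ω → Euc p} (hmem : ∀ k ω, θ k ω ∈ Θ)
    (hstep : ∀ k ω, IsProjection Θ (θ k ω - γ k • (H (θ k ω) + β k ω)) (θ (k + 1) ω))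
    (hθ : ∀ k, Measurable[ℱ k] (θ k)) (h0 : Integrable (fun ω => ‖θ 0 ω‖ ^ 2) P)
    (hβ : ∀ k, Integrable (β k) P) (hβ2 : ∀ k, Integrable (fun ω => ‖β k ω‖ ^ 2) P)
    (hβ0 : ∀ k, P[β k | ℱ k] =ᵐ[P] 0) {ν : ℝ} (hν : ∀ k, ∫ ω, ‖β k ω‖ ^ 2 ∂P ≤ ν) :
    (∀ k, Integrable (fun ω => ‖θ k ω - s‖ ^ 2) P) ∧
      Summable fun k => γ k * ∫ ω, ‖θ k ω - s‖ ^ 2 ∂P := by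
  -- The drift κγ is 2γ times the κ/2 of strong convexity. The factors 3 come from splitting the
  -- sampled gradient into H(s), H(θ) - H(s) and β; H(s) may be nonzero when s is on the boundary of
  -- Θ.
  have hpt : ∀ k ω, ‖θ (k + 1) ω - s‖ ^ 2 ≤ (1 - κ * γ k + 3 * R ^ 2 * γ k ^ 2) * ‖θ k ω - s‖ ^ 2
      + (-2 * γ k) * inner ℝ (θ k ω - s) (β k ω) + 3 * γ k ^ 2 * ‖β k ω‖ ^ 2
      + 3 * γ k ^ 2 * ‖H s‖ ^ 2 := by
    intro k ω
    refine ((hstep k ω).dist_sq_le hΘ hs).trans ?_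
    have h1 : ‖θ k ω - γ k • (H (θ k ω) + β k ω) - s‖ ^ 2 = ‖θ k ω - s‖ ^ 2
        - 2 * γ k * (inner ℝ (H (θ k ω)) (θ k ω - s) + inner ℝ (θ k ω - s) (β k ω))
        + γ k ^ 2 * ‖H (θ k ω) + β k ω‖ ^ 2 := by
      rw [sub_right_comm, norm_sub_sq_real, real_inner_smul_right, norm_smul, mul_pow,
        Real.norm_eq_abs, sq_abs, inner_add_right, real_inner_comm (H (θ k ω))]
      ring
    have h2 := hconv.le_inner_sub_minimizer (hmem k ω) hs (hgrad _ (hmem k ω)) hmin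
    have h3 : ‖H (θ k ω) + β k ω‖ ^ 2
        ≤ 3 * (‖H s‖ ^ 2 + R ^ 2 * ‖θ k ω - s‖ ^ 2 + ‖β k ω‖ ^ 2) := by
      have h := norm_add_add_sq_le (H s) (H (θ k ω) - H s) (β k ω)
      rw [add_sub_cancel] at h
      have h' : ‖H (θ k ω) - H s‖ ^ 2 ≤ (R * ‖θ k ω - s‖) ^ 2 := by
        gcongr; exact hlip _ (hmem k ω) _ hs
      rw [mul_pow] at h'
      linarith
    have h4 := mul_le_mul_of_nonneg_left h2 (hγ k).le
    have h5 := mul_le_mul_of_nonneg_left h3 (sq_nonneg (γ k))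
    rw [h1]
    linarith
  have hθm : ∀ k, Measurable (θ k) := fun k => (hθ k).mono (hℱ k) le_rfl
  have hem : ∀ k, AEStronglyMeasurable (fun ω => θ k ω - s) P := fun k =>
    ((hθm k).sub_const s).aestronglyMeasurable
  have hinner : ∀ k, Integrable (fun ω => ‖θ k ω - s‖ ^ 2) P →
      Integrable (fun ω => inner ℝ (θ k ω - s) (β k ω)) P := fun k hk =>
    integrable_inner_of_sq (hem k) (hβ k).1 hk (hβ2 k)
  have hint : ∀ k, Integrable (fun ω => ‖θ k ω - s‖ ^ 2) P := by
    intro k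
    induction k with
    | zero =>
      refine ((h0.const_mul 2).add (integrable_const (2 * ‖s‖ ^ 2))).mono' ((hem 0).norm.pow 2)
        (Eventually.of_forall fun ω => ?_)
      rw [Real.norm_eq_abs, abs_of_nonneg (sq_nonneg _)]
      have := norm_sub_le (θ 0 ω) s
      simp only [Pi.add_apply]
      nlinarith [sq_nonneg (‖θ 0 ω‖ - ‖s‖), norm_nonneg (θ 0 ω - s)]
    | succ k ih =>
      have hdom := (((ih.const_mul (1 - κ * γ k + 3 * R ^ 2 * γ k ^ 2)).add
        ((hinner k ih).const_mul (-2 * γ k))).add ((hβ2 k).const_mul (3 * γ k ^ 2))).add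
        (integrable_const (3 * γ k ^ 2 * ‖H s‖ ^ 2))
      refine hdom.mono' ((hem (k + 1)).norm.pow 2) (Eventually.of_forall fun ω => ?_)
      rw [Real.norm_eq_abs, abs_of_nonneg (sq_nonneg _)]
      exact hpt k ω
  refine ⟨hint, summable_mul_of_contraction (U := fun k => ∫ ω, ‖θ k ω - s‖ ^ 2 ∂P) (κ := κ)
    (a := 3 * R ^ 2) (c := 3 * ν + 3 * ‖H s‖ ^ 2) hκ hγ hγ2
    (fun k => integral_nonneg fun ω => sq_nonneg _) fun k => ?_⟩
  have hzero : ∫ ω, inner ℝ (θ k ω - s) (β k ω) ∂P = 0 :=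
    integral_eq_zero_of_condExp_eq_zero (hℱ k) (condExp_inner_eq_zero
      ((hθ k).sub_const s).stronglyMeasurable (hβ k) (hinner k (hint k)) (hβ0 k))
  have i1 := (hint k).const_mul (1 - κ * γ k + 3 * R ^ 2 * γ k ^ 2)
  have i2 := (hinner k (hint k)).const_mul (-2 * γ k)
  have i3 := (hβ2 k).const_mul (3 * γ k ^ 2)
  have i12 := i1.add i2
  have i123 := i12.add i3
  have hle := integral_mono (hint (k + 1)) (i123.add (integrable_const _)) (hpt k)
  have heq : ∫ ω, ((1 - κ * γ k + 3 * R ^ 2 * γ k ^ 2) * ‖θ k ω - s‖ ^ 2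
      + (-2 * γ k) * inner ℝ (θ k ω - s) (β k ω) + 3 * γ k ^ 2 * ‖β k ω‖ ^ 2
      + 3 * γ k ^ 2 * ‖H s‖ ^ 2) ∂P
      = (1 - κ * γ k + 3 * R ^ 2 * γ k ^ 2) * ∫ ω, ‖θ k ω - s‖ ^ 2 ∂P
        + 3 * γ k ^ 2 * ∫ ω, ‖β k ω‖ ^ 2 ∂P + 3 * γ k ^ 2 * ‖H s‖ ^ 2 := by
    rw [integral_add (by exact i123) (integrable_const _), integral_add (by exact i12) i3,
      integral_add i1 i2, integral_const_mul, integral_const_mul, integral_const_mul, hzero]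
    simp
  have hle' := hle.trans_eq heq
  have h5 : 3 * γ k ^ 2 * ∫ ω, ‖β k ω‖ ^ 2 ∂P ≤ 3 * γ k ^ 2 * ν := by gcongr; exact hν k
  linarith

/-! ### Consequences of the stepsize conditions -/

section Stepsizes

variable {α : ℕ → ℝ} {τ : ℝ}

theorem rpow_two_sub_mul_rpow {a : ℝ} (ha : 0 < a) : a ^ (2 - τ) * a ^ τ = a ^ 2 := by
  rw [← Real.rpow_add ha, sub_add_cancel]
  norm_cast

theorem exists_sq_le_mul_rpow (hα : ∀ k, 0 < α k) (hs : Summable fun k => α k ^ (2 - τ)) :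
    ∃ M, ∀ k, α k ^ 2 ≤ M * α k ^ τ := by
  refine ⟨∑' k, α k ^ (2 - τ), fun k => ?_⟩
  rw [← rpow_two_sub_mul_rpow (τ := τ) (hα k)]
  have := Real.rpow_nonneg (hα k).le τ
  gcongr
  exact hs.le_tsum k fun j _ => Real.rpow_nonneg (hα j).le _

theorem summable_sq_of_summable_rpow (hα : ∀ k, 0 < α k) (hτ0 : 0 < τ) (hτ2 : τ < 2)
    (hs : Summable fun k => α k ^ (2 - τ)) : Summable fun k => α k ^ 2 := by
  refine Summable.of_norm_bounded_eventually_nat hs ?_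
  filter_upwards [hs.tendsto_atTop_zero.eventually_lt_const one_pos] with k hk
  have h1 : α k ≤ 1 := by
    by_contra h
    exact hk.not_gt (Real.one_lt_rpow (not_le.1 h) (by linarith))
  rw [Real.norm_eq_abs, abs_of_nonneg (sq_nonneg _), ← rpow_two_sub_mul_rpow (τ := τ) (hα k)]
  exact mul_le_of_le_one_right (Real.rpow_nonneg (hα k).le _)
    (Real.rpow_le_one (hα k).le h1 hτ0.le)

theorem summable_rpow_mul_of_summable_mul {γ U : ℕ → ℝ} (hα : ∀ k, 0 < α k) (hγ : ∀ k, 0 < γ k)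
    (hU : ∀ k, 0 ≤ U k) (hlim : Tendsto (fun k => α k ^ τ / γ k) atTop (𝓝 0))
    (hs : Summable fun k => γ k * U k) : Summable fun k => α k ^ τ * U k := by
  refine Summable.of_norm_bounded_eventually_nat hs ?_
  filter_upwards [hlim.eventually_lt_const one_pos] with k hk
  rw [div_lt_one (hγ k)] at hk
  have := Real.rpow_nonneg (hα k).le τ
  rw [Real.norm_eq_abs, abs_of_nonneg (mul_nonneg this (hU k))]
  exact mul_le_mul_of_nonneg_right hk.le (hU k)

/-- (αt)² is the product of α^(2-τ) and α^τ t², so αt is at most their sum. -/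
theorem summable_mul_of_summable_rpow_mul_sq {t : ℕ → ℝ} (hα : ∀ k, 0 < α k) (ht : ∀ k, 0 ≤ t k)
    (hs : Summable fun k => α k ^ (2 - τ)) (hst : Summable fun k => α k ^ τ * t k ^ 2) :
    Summable fun k => α k * t k := by
  refine Summable.of_nonneg_of_le (fun k => mul_nonneg (hα k).le (ht k)) (fun k => ?_) (hs.add hst)
  have h1 := Real.rpow_nonneg (hα k).le (2 - τ)
  have h2 := Real.rpow_nonneg (hα k).le τ
  refine le_of_sq_le_sq ?_ (by positivity)
  have h3 : (α k * t k) ^ 2 = α k ^ (2 - τ) * (α k ^ τ * t k ^ 2) := by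
    rw [← mul_assoc, rpow_two_sub_mul_rpow (hα k), mul_pow]
  rw [h3]
  nlinarith [sq_nonneg (α k ^ (2 - τ)), sq_nonneg (α k ^ τ * t k ^ 2),
    mul_nonneg h1 (mul_nonneg h2 (sq_nonneg (t k)))]

end Stepsizes

/-! ### Measurable limit and conclusion -/

/-- If almost every trajectory converges to a point of `S`, the limit can be chosen measurable and
with all its values in `S`. -/
theorem exists_measurable_limit {n : ℕ} {Ω : Type*} [MeasurableSpace Ω] {P : Measure Ω}
    [IsProbabilityMeasure P] {ι : Type*} [Nonempty ι] {x : ι → ℕ → Ω → Euc n} {S : Set (Euc n)}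
    (hx : ∀ j k, Measurable (x j k))
    (h : ∀ᵐ ω ∂P, ∃ z ∈ S, ∀ j, Tendsto (fun k => x j k ω) atTop (𝓝 z)) :
    ∃ z : Ω → Euc n, Measurable z ∧ (∀ ω, z ω ∈ S) ∧
      ∀ᵐ ω ∂P, ∀ j, Tendsto (fun k => x j k ω) atTop (𝓝 (z ω)) := by
  classical
  -- Replacing the iterates by the constant z₀ on a measurable null set T makes the limit exist
  -- everywhere, hence measurable.
  obtain ⟨T, hTsub, hTm, hT0⟩ := exists_measurable_superset_of_null h
  obtain ⟨ω₀, z₀, hz₀, -⟩ := h.exists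
  have hgood : ∀ ω, ∃ z ∈ S, ω ∉ T → ∀ j, Tendsto (fun k => x j k ω) atTop (𝓝 z) := fun ω => by
    by_cases hω : ω ∈ T
    · exact ⟨z₀, hz₀, fun h => (h hω).elim⟩
    · obtain ⟨z, hz, hlim⟩ := not_not.1 fun hn => hω (hTsub hn)
      exact ⟨z, hz, fun _ => hlim⟩
  choose z hzS hz using hgood
  obtain ⟨j⟩ := ‹Nonempty ι›
  refine ⟨fun ω => if ω ∈ T then z₀ else z ω, ?_, fun ω => ?_, ?_⟩
  · refine measurable_of_tendsto_metrizable (f := fun k ω => if ω ∈ T then z₀ else x j k ω)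
      (fun k => Measurable.ite hTm measurable_const (hx j k)) (tendsto_pi_nhds.2 fun ω => ?_)
    by_cases hω : ω ∈ T
    · simp only [hω, if_true]
      exact tendsto_const_nhds
    · simpa only [hω, if_false] using hz ω hω j
  · by_cases hω : ω ∈ T
    · simpa only [hω, if_true] using hz₀
    · simpa only [hω, if_false] using hzS ω
  · have : ∀ᵐ ω ∂P, ω ∉ T := measure_eq_zero_iff_ae_notMem.1 hT0
    filter_upwards [this] with ω hω j
    simpa only [hω, if_false] using hz ω hω j

theorem mainTheorem1 {m n p d r : ℕ}
    -- the probability space and the laws of the random variables `ξ` and `χ`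
    {Ω : Type*} [MeasurableSpace Ω] (P : Measure Ω) [IsProbabilityMeasure P]
    (μξ : Measure (Euc d)) [IsProbabilityMeasure μξ]
    (μχ : Measure (Euc r)) [IsProbabilityMeasure μχ]
    -- sampled costs, sampled learning function, feasible sets
    (φ : Fin m → Euc n → Euc p → Euc d → ℝ) (g : Euc p → Euc r → ℝ)
    (X : Fin m → Set (Euc n)) (Θ : Set (Euc p))
    (hφ_meas : ∀ i, Measurable (fun q : Euc n × Euc p × Euc d => φ i q.1 q.2.1 q.2.2))
    (hφ_diff : ∀ i, ∀ θ ∈ Θ, ∀ s, ContDiff ℝ 1 (fun x => φ i x θ s))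
    (hg_meas : Measurable (fun q : Euc p × Euc r => g q.1 q.2))
    (hg_diff : ∀ c, ContDiff ℝ 1 (fun θ => g θ c))
    -- `f_i` and `h` are finite expectations, and their gradients are the expected gradients
    (hφ_int : ∀ i x, ∀ θ ∈ Θ, Integrable (fun s => φ i x θ s) μξ)
    (hφ_grad_int : ∀ i x, ∀ θ ∈ Θ, Integrable (fun s => gradient (fun y => φ i y θ s) x) μξ)
    (hf_grad : ∀ i x, ∀ θ ∈ Θ,
      HasGradientAt (fun y => localCost φ μξ i y θ) (localGrad φ μξ i x θ) x)
    (hg_int : ∀ θ ∈ Θ, Integrable (fun c => g θ c) μχ)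
    (hg_grad_int : ∀ θ ∈ Θ, Integrable (fun c => gradient (fun t => g t c) θ) μχ)
    (hh_grad : ∀ θ ∈ Θ, HasGradientWithinAt (expVal g μχ) (expGrad g μχ θ) Θ θ)
    -- graphs and weight matrices
    (G : ℕ → SimpleGraph (Fin m)) (A : ℕ → Matrix (Fin m) (Fin m) ℝ)
    (hG : ∀ k, (G k).Connected)
    (hA_pos : ∀ k i j, (j = i ∨ (G k).Adj j i) → 0 < A k i j)
    (hA_zero : ∀ k i j, ¬ (j = i ∨ (G k).Adj j i) → A k i j = 0)
    (hA_stoch : ∀ k, A k ∈ doublyStochastic ℝ (Fin m))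
    (hA_lower : ∃ η : ℝ, 0 < η ∧ ∀ k i j, 0 < A k i j → η ≤ A k i j)
    -- feasible sets
    (hX_convex : ∀ i, Convex ℝ (X i)) (hX_compact : ∀ i, IsCompact (X i))
    (hX_interior : (interior (⋂ i, X i)).Nonempty)
    (hΘ_convex : Convex ℝ Θ) (hΘ_closed : IsClosed Θ)
    -- agent objectives
    (hf_convex : ∀ i, ∀ θ ∈ Θ, ConvexOn ℝ univ (fun x => localCost φ μξ i x θ))
    (hf_lip : ∃ L : ℝ, ∀ i, ∀ x ∈ convexHull ℝ (⋃ j, X j), ∀ θ ∈ Θ, ∀ θ' ∈ Θ,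
      ‖localGrad φ μξ i x θ - localGrad φ μξ i x θ'‖ ≤ L * ‖θ - θ'‖)
    -- learning function, and its minimizer over `Θ`
    (hh_convex : ∃ κ : ℝ, 0 < κ ∧ StrongConvexOn Θ κ (expVal g μχ))
    (hh_lip : ∃ R : ℝ, ∀ θ ∈ Θ, ∀ θ' ∈ Θ,
      ‖expGrad g μχ θ - expGrad g μχ θ'‖ ≤ R * ‖θ - θ'‖)
    (θstar : Euc p) (hθstar_mem : θstar ∈ Θ) (hθstar_min : IsMinOn (expVal g μχ) Θ θstar)
    -- stepsizes
    (α γ : ℕ → ℝ) (hα_pos : ∀ k, 0 < α k) (hγ_pos : ∀ k, 0 < γ k)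
    (hγ_div : ¬ Summable γ) (hγ_sq : Summable (fun k => γ k ^ 2)) (hα_div : ¬ Summable α)
    (hατ : ∃ τ : ℝ, 0 < τ ∧ τ < 2 ∧ Summable (fun k => α k ^ (2 - τ)) ∧
      Tendsto (fun k => α k ^ τ / γ k) atTop (𝓝 0))
    -- the samples and the iterates of the algorithm
    (ξ : Fin m → ℕ → Ω → Euc d) (χ : Fin m → ℕ → Ω → Euc r)
    (x : Fin m → ℕ → Ω → Euc n) (θ : Fin m → ℕ → Ω → Euc p)
    (hξ_meas : ∀ i k, Measurable (ξ i k)) (hχ_meas : ∀ i k, Measurable (χ i k))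
    (hx0_meas : ∀ i, Measurable (x i 0)) (hθ0_meas : ∀ i, Measurable (θ i 0))
    (hx0_mem : ∀ i ω, x i 0 ω ∈ X i) (hθ0_mem : ∀ i ω, θ i 0 ω ∈ Θ)
    (hx_step : ∀ i k ω, IsProjection (X i)
      (average A x i k ω - α k • (localGrad φ μξ i (average A x i k ω) (θ i k ω)
        + costNoise φ μξ A x θ ξ i k ω))
      (x i (k + 1) ω))
    (hθ_step : ∀ i k ω, IsProjection Θ
      (θ i k ω - γ k • (expGrad g μχ (θ i k ω) + learnNoise g μχ θ χ i k ω))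
      (θ i (k + 1) ω))
    -- conditional first and second moments of the errors
    (hw_int : ∀ i k, Integrable (costNoise φ μξ A x θ ξ i k) P)
    (hw_sq_int : ∀ i k, Integrable (fun ω => ‖costNoise φ μξ A x θ ξ i k ω‖ ^ 2) P)
    (hβ_int : ∀ i k, Integrable (learnNoise g μχ θ χ i k) P)
    (hβ_sq_int : ∀ i k, Integrable (fun ω => ‖learnNoise g μχ θ χ i k ω‖ ^ 2) P)
    (hw_mean : ∀ i k, P[costNoise φ μξ A x θ ξ i k | history x θ ξ χ k] =ᵐ[P] 0)
    (hβ_mean : ∀ i k, P[learnNoise g μχ θ χ i k | history x θ ξ χ k] =ᵐ[P] 0)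
    (hw_var : ∃ ν : ℝ, ∀ i k,
      P[fun ω => ‖costNoise φ μξ A x θ ξ i k ω‖ ^ 2 | history x θ ξ χ k]
        ≤ᵐ[P] fun _ => ν ^ 2)
    (hβ_var : ∃ νθ : ℝ, ∀ i k,
      P[fun ω => ‖learnNoise g μχ θ χ i k ω‖ ^ 2 | history x θ ξ χ k]
        ≤ᵐ[P] fun _ => νθ ^ 2)
    (hθ0_sq : ∀ i, Integrable (fun ω => ‖θ i 0 ω‖ ^ 2) P) :
    ∃ z : Ω → Euc n, Measurable z ∧ (∀ ω, z ω ∈ solutionSet φ μξ X θstar) ∧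
      ∀ᵐ ω ∂P, ∀ j, Tendsto (fun k => x j k ω) atTop (𝓝 (z ω)) := by
  obtain ⟨η, hη, hA_lower⟩ := hA_lower
  obtain ⟨L, hf_lip⟩ := hf_lip
  obtain ⟨κ, hκ, hh_convex⟩ := hh_convex
  obtain ⟨R, hh_lip⟩ := hh_lip
  obtain ⟨τ, hτ0, hτ2, hατ, hlim⟩ := hατ
  obtain ⟨ν, hw_var⟩ := hw_var
  obtain ⟨νθ, hβ_var⟩ := hβ_var
  have hne : Nonempty (Fin m) := (hG 0).nonempty
  have hx_mem : ∀ i k ω, x i k ω ∈ X i := fun i k ω => by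
    cases k with
    | zero => exact hx0_mem i ω
    | succ k => exact (hx_step i k ω).1
  have hθ_mem : ∀ i k ω, θ i k ω ∈ Θ := fun i k ω => by
    cases k with
    | zero => exact hθ0_mem i ω
    | succ k => exact (hθ_step i k ω).1
  have hv_mem : ∀ i k ω, average A x i k ω ∈ convexHull ℝ (⋃ j, X j) := fun i k ω =>
    (convex_convexHull ℝ _).sum_mem (fun j _ => nonneg_of_mem_doublyStochastic (hA_stoch k))
      (sum_row_of_mem_doublyStochastic (hA_stoch k) i)
      fun j _ => subset_convexHull ℝ _ (mem_iUnion.2 ⟨j, hx_mem j k ω⟩)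
  obtain ⟨r, hr⟩ : ∃ r, ∀ y ∈ convexHull ℝ (⋃ j, X j), ‖y‖ ≤ r :=
    (isBounded_convexHull.2 (isCompact_iUnion hX_compact).isBounded).exists_norm_le
  -- measurability
  have hℱ := history_le hx0_meas hθ0_meas hξ_meas hχ_meas
  let ℱ : Filtration ℕ _ := ⟨history x θ ξ χ, fun _ _ h => history_mono h, hℱ⟩
  have hmeas := measurable_iterates (A := A) (α := α) (γ := γ) hφ_meas hφ_diff hg_meas hg_diff
    hX_convex (fun i => (hX_compact i).isClosed) hΘ_convex hΘ_closed hθ_mem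
    (fun i k ω => by simpa only [costNoise, add_sub_cancel] using hx_step i k ω)
    (fun i k ω => by simpa only [learnNoise, add_sub_cancel] using hθ_step i k ω)
  have hv_meas : ∀ i k, Measurable[history x θ ξ χ k] (average A x i k) := fun i k =>
    @measurable_average Ω m n (history x θ ξ χ k) A x k (hmeas k).1 i
  have hw_meas : ∀ i k, Measurable[history x θ ξ χ (k + 1)] (costNoise φ μξ A x θ ξ i k) := by
    intro i k
    have hle := history_mono (x := x) (θ := θ) (ξ := ξ) (χ := χ) k.le_succ
    have hv := (hv_meas i k).mono hle le_rfl
    have hθ := ((hmeas k).2 i).mono hle le_rfl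
    have hξ := (measurable_samples (x := x) (θ := θ) (ξ := ξ) (χ := χ) i k.lt_succ_self).1
    let _ : MeasurableSpace Ω := history x θ ξ χ (k + 1)
    exact (measurable_gradient_comp (hφ_meas i) (hφ_diff i) hv hθ hξ (hθ_mem i k)).sub
      (measurable_localGrad_comp (hφ_meas i) (hf_grad i) hv hθ (hθ_mem i k))
  -- summability of the perturbations
  have hα2 := summable_sq_of_summable_rpow hα_pos hτ0 hτ2 hατ
  obtain ⟨M, hM⟩ := exists_sq_le_mul_rpow hα_pos hατ
  have hw_le : ∀ i k, ∫ ω, ‖costNoise φ μξ A x θ ξ i k ω‖ ^ 2 ∂P ≤ ν ^ 2 := fun i k =>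
    integral_le_of_condExp_le (hℱ k) (hw_var i k)
  have hlearn : ∀ i, ∀ᵐ ω ∂P, Summable fun k => α k ^ τ * ‖θ i k ω - θstar‖ ^ 2 := fun i => by
    obtain ⟨hint, hsum⟩ := summable_stochastic_gradient (β := learnNoise g μχ θ χ i) hℱ hΘ_convex
      hκ hh_convex hh_grad hh_lip hθstar_mem hθstar_min hγ_pos hγ_sq (hθ_mem i) (hθ_step i)
      (fun k => (hmeas k).2 i) (hθ0_sq i) (hβ_int i) (hβ_sq_int i) (hβ_mean i)
      (fun k => integral_le_of_condExp_le (hℱ k) (hβ_var i k))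
    refine ae_summable_of_summable_integral
      (fun k ω => mul_nonneg (Real.rpow_nonneg (hα_pos k).le _) (sq_nonneg _))
      (fun k => (hint k).const_mul _) ?_
    simp_rw [integral_const_mul]
    exact summable_rpow_mul_of_summable_mul hα_pos hγ_pos
      (fun k => integral_nonneg fun ω => sq_nonneg _) hlim hsum
  have hnoise : ∀ i, ∀ᵐ ω ∂P, Summable fun k =>
      α k ^ 2 * ‖costNoise φ μξ A x θ ξ i k ω‖ ^ 2 := fun i => by
    refine ae_summable_of_summable_integral (fun k ω => by positivity)
      (fun k => (hw_sq_int i k).const_mul _) ?_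
    simp_rw [integral_const_mul]
    exact Summable.of_nonneg_of_le
      (fun k => mul_nonneg (sq_nonneg _) (integral_nonneg fun ω => sq_nonneg _))
      (fun k => mul_le_mul_of_nonneg_left (hw_le i k) (sq_nonneg _)) (hα2.mul_right _)
  have hseries : ∀ i (u : ℕ → Ω → Euc n), (∀ k, Measurable[history x θ ξ χ k] (u k)) →
      (∃ r, ∀ k ω, ‖u k ω‖ ≤ r) → ∀ᵐ ω ∂P, SeriesConverges fun k =>
        α k * inner ℝ (costNoise φ μξ A x θ ξ i k ω) (u k ω) := by
    rintro i u hu ⟨r, hr⟩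
    exact ae_seriesConverges_inner (ℱ := ℱ) (fun k => (hw_meas i k).stronglyMeasurable) (hw_int i)
      (hw_sq_int i) (hw_mean i) (hw_le i) hα2 (fun k => (hu k).stronglyMeasurable) hr
  have hwv : ∀ i, ∀ᵐ ω ∂P, SeriesConverges fun k =>
      α k * inner ℝ (costNoise φ μξ A x θ ξ i k ω) (average A x i k ω) := fun i =>
    hseries i _ (hv_meas i) ⟨r, fun k ω => hr _ (hv_mem i k ω)⟩
  -- Only the finitely many basis vectors are treated here, so the exceptional null set does not
  -- depend on z.
  have hwe : ∀ i l, ∀ᵐ ω ∂P, SeriesConverges fun k =>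
      α k * inner ℝ (costNoise φ μξ A x θ ξ i k ω) (EuclideanSpace.single l (1 : ℝ)) := fun i l =>
    hseries i (fun _ _ => EuclideanSpace.single l 1) (fun k => measurable_const) ⟨_, fun _ _ => le_rfl⟩
  refine exists_measurable_limit (fun j k => ((hmeas k).1 j).mono (hℱ k) le_rfl) ?_
  filter_upwards [ae_all_iff.2 hlearn, ae_all_iff.2 hnoise, ae_all_iff.2 hwv,
    ae_all_iff.2 fun i => ae_all_iff.2 (hwe i)] with ω h1 h2 h3 h4
  refine exists_minimizer_tendsto (f := fun i y => localCost φ μξ i y θstar)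
    (f' := fun i y => localGrad φ μξ i y θstar) (x := fun i k => x i k ω)
    (v := fun i k => average A x i k ω)
    (d := fun i k => localGrad φ μξ i (average A x i k ω) (θ i k ω))
    (w := fun i k => costNoise φ μξ A x θ ξ i k ω) (ε := fun i k => L * ‖θ i k ω - θstar‖)
    (fun i => hf_convex i _ hθstar_mem) (fun i y => hf_grad i y _ hθstar_mem) hX_convex hX_compact
    hX_interior hA_stoch hG hη (fun k i j h => hA_lower k i j (hA_pos k i j h)) hα_pos hα_div hα2
    (fun i k => rfl) (fun i k => hx_mem i k ω) (fun i k => hx_step i k ω)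
    (fun i k => hf_lip i _ (hv_mem i k ω) _ (hθ_mem i k ω) _ hθstar_mem)
    (fun i => ?_) (fun i => ?_) h2 h3 (fun i z => ?_)
  · have h := (summable_mul_of_summable_rpow_mul_sq hα_pos (fun k => norm_nonneg _) hατ
      (h1 i)).mul_left L
    exact h.congr fun k => by ring
  -- Here α² ≤ Mα^τ reduces the squared errors to the summable α^τ‖θ - θ*‖².
  · refine Summable.of_nonneg_of_le (fun k => by positivity) (fun k => ?_)
      ((h1 i).mul_left (L ^ 2 * M))
    have h := mul_le_mul_of_nonneg_left (hM k) (mul_nonneg (sq_nonneg L)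
      (sq_nonneg ‖θ i k ω - θstar‖))
    linarith
  · have h := SeriesConverges.sum (s := Finset.univ) fun l _ => (h4 i l).const_mul (z l)
    convert h using 2 with k
    simp only [PiLp.inner_apply, Finset.mul_sum]
    refine Finset.sum_congr rfl fun l _ => ?_
    simp
    ring
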